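/- Let $\mathbb K$ be a commutative ring in which $2$ and $3$ are invertible, and let $(V^+,V^-)$ be a linear Jordan pair over $\mathbb K$: $\mathbb K$-modules with trilinear maps $T^\pm:V^\pm\times V^\mp\times V^\pm\to V^\pm$ such that $T^\pm(x,y,z)=T^\pm(z,y,x)$ and $$T^\pm(u,v,T^\pm(x,y,z))=T^\pm(T^\pm(u,v,x),y,z)-T^\pm(x,T^\mp(v,u,y),z)+T^\pm(x,y,T^\pm(u,v,z)).$$ Put $Q^\pm(x)y=\tfrac12T^\pm(x,y,x)$, $B(x,y)=\mathrm{id}-T^+(x,y,\cdot)+Q^+(x)Q^-(y)$ for $x\in V^+$, $y\in V^-$, and $x^y=B(x,y)^{-1}(x-Q^+(x)y)$ if $B(x,y)$ is invertible. For $a\in V^-$ let $\mathcal U_a=\{x\in V^+: B(x,-a)\in \mathrm{GL}(V^+)\}$, with product $$\mu(x,y)=\sigma_x(y)=2x+Q^+(x)a+B(x,-a)\bigl((-y)^a\bigr).$$ A *symmetric space* here is a set $M$, open in a submodule $W$ of a $\mathbb K$-module in the sense that $W$ is its tangent space at every point, with a product $\mu(x,y)=\sigma_x(y)\in M$ that is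 extended to the tangent bundle $M\times W$, a pair $(x,v)$ standing for $x+\varepsilon v$, by the same formula over the dual numbers $\mathbb K[\varepsilon]$, $\varepsilon^2=0$, such that $\sigma_x(x)=x$, $\sigma_x^2=\mathrm{id}$, $\sigma_x\sigma_y\sigma_x=\sigma_{\sigma_x(y)}$ and $\sigma_x(x+\varepsilon v)=x-\varepsilon v$. A *symmetric subspace* of $\mathcal U_a$ is an intersection of $\mathcal U_a$ with a submodule $W$ of $V^+$ which is stable under $\mu$ and is a symmetric space, with tangent spaces $W$, for the induced product. An *isomorphism* is a polynomial bijection with polynomial inverse, whose formal differentials are inverse to each other on the tangent spaces, that is compatible with the products and with their extensions to the tangent bundles. For a unital Jordan algebra $A$ with quadratic operators $U_x$, the set $A^\times=\{x: U_x \text{ invertible}\}$ carries the product $\mu(x,y)=U_x(y^{-1})$, where $y^{-1}=U_y^{-1}y$. Let $(e^+,e^-)\in V^+\times V^-$ be an idempotent, i.e. $Q^+(e^+)e^-=e^+$ and $Q^-(e^-)e^+=e^-$ (so $e=e^-$ is von Neumann regular). For $i=0,1,2$ let $V_i=\{x\in V^+:T^+(e^+,e^-,x)=i\,x\}$. Then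 $V_2$ is a unital Jordan algebra with product $\tfrac12T^+(x,e^-,y)$ and unit $e^+$. **Theorem.** One has $V^+=V_2\oplus V_1\oplus V_0$, and: 1. $\mathcal U_e=\{x_0+x_1+x_2 : x_0\in V_0,\ x_1\in V_1,\ x_2\in V_2,\ x_2+e^+\in (V_2)^\times\}$. 2. $\mathcal U_e\cap V_2=(V_2)^\times-e^+$. This set (the base) is a symmetric subspace of $\mathcal U_e$, isomorphic to the symmetric space $(V_2)^\times$ of invertible elements of the Jordan algebra $V_2$. 3. $V_1\oplus V_0\subseteq\mathcal U_e$. This set (the fiber) is a symmetric subspace of $\mathcal U_e$, isomorphic to $V_1\oplus V_0$ with the flat symmetric space structure $\mu(x,y)=2x-y$. -/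

import Mathlib

/-- A linear Jordan pair over `K`: two modules with trilinear maps
`T⁺ : V⁺ × V⁻ × V⁺ → V⁺` and `T⁻ : V⁻ × V⁺ × V⁻ → V⁻` which are symmetric in the outer
variables and satisfy the five-linear Jordan identity. -/
structure LinearJordanPair (K Vp Vm : Type*) [CommRing K] [AddCommGroup Vp] [Module K Vp]
    [AddCommGroup Vm] [Module K Vm] where
  Tp : Vp →ₗ[K] Vm →ₗ[K] Vp →ₗ[K] Vp
  Tm : Vm →ₗ[K] Vp →ₗ[K] Vm →ₗ[K] Vm
  symm_p : ∀ x y z, Tp x y z = Tp z y x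
  symm_m : ∀ x y z, Tm x y z = Tm z y x
  jordan_p : ∀ u v x y z,
    Tp u v (Tp x y z) = Tp (Tp u v x) y z - Tp x (Tm v u y) z + Tp x y (Tp u v z)
  jordan_m : ∀ u v x y z,
    Tm u v (Tm x y z) = Tm (Tm u v x) y z - Tm x (Tp v u y) z + Tm x y (Tm u v z)

/-- A unital (linear) Jordan algebra over `K` on the module `J`. -/
structure UnitalJordanAlgebra (K J : Type*) [CommRing K] [AddCommGroup J] [Module K J] where
  mul : J →ₗ[K] J →ₗ[K] J
  one : J
  mul_comm : ∀ x y, mul x y = mul y x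
  one_mul : ∀ x, mul one x = x
  jordan : ∀ x y, mul x (mul (mul x x) y) = mul (mul x x) (mul x y)

section DualNumbers

/-- The scalar extension of a bilinear map by the dual numbers, `V ⊕ ε V` being written as
`V × V`: `(x + ε x') (y + ε y') = x y + ε (x' y + x y')`. -/
def dualBilin {K A B C : Type*} [CommRing K] [AddCommGroup A] [Module K A]
    [AddCommGroup B] [Module K B] [AddCommGroup C] [Module K C]
    (m : A →ₗ[K] B →ₗ[K] C) : (A × A) →ₗ[K] (B × B) →ₗ[K] (C × C) :=
  LinearMap.mk₂ K (fun x y => (m x.1 y.1, m x.2 y.1 + m x.1 y.2))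
    (by intro a b c; ext <;> simp; abel)
    (by intro r a b; ext <;> simp)
    (by intro a b c; ext <;> simp; abel)
    (by intro r a b; ext <;> simp)

/-- The scalar extension of a trilinear map by the dual numbers. -/
def dualTrilin {K A B C D : Type*} [CommRing K] [AddCommGroup A] [Module K A]
    [AddCommGroup B] [Module K B] [AddCommGroup C] [Module K C] [AddCommGroup D] [Module K D]
    (T : A →ₗ[K] B →ₗ[K] C →ₗ[K] D) :
    (A × A) →ₗ[K] (B × B) →ₗ[K] (C × C) →ₗ[K] (D × D) :=
  LinearMap.mk₂ K
    (fun x y => LinearMap.prod (T x.1 y.1 ∘ₗ LinearMap.fst K C C)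
      ((T x.2 y.1 + T x.1 y.2) ∘ₗ LinearMap.fst K C C + T x.1 y.1 ∘ₗ LinearMap.snd K C C))
    (by intro a b c; ext <;> simp; abel)
    (by intro r a b; ext <;> simp)
    (by intro a b c; ext <;> simp; abel)
    (by intro r a b; ext <;> simp)

theorem dualBilin_apply {K A B C : Type*} [CommRing K] [AddCommGroup A] [Module K A]
    [AddCommGroup B] [Module K B] [AddCommGroup C] [Module K C]
    (m : A →ₗ[K] B →ₗ[K] C) (x : A × A) (y : B × B) :
    dualBilin m x y = (m x.1 y.1, m x.2 y.1 + m x.1 y.2) := rfl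

theorem dualTrilin_apply {K A B C D : Type*} [CommRing K] [AddCommGroup A] [Module K A]
    [AddCommGroup B] [Module K B] [AddCommGroup C] [Module K C] [AddCommGroup D] [Module K D]
    (T : A →ₗ[K] B →ₗ[K] C →ₗ[K] D) (x : A × A) (y : B × B) (z : C × C) :
    dualTrilin T x y z =
      (T x.1 y.1 z.1, T x.2 y.1 z.1 + T x.1 y.2 z.1 + T x.1 y.1 z.2) := rfl

end DualNumbers

section PolynomialMaps

/-- A polynomial map between `K`-modules: a finite sum of homogeneous terms
`x ↦ p_k (x, …, x)` with `p_k` multilinear, `k < bound`. -/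
structure PolyMap (K V W : Type*) [CommRing K] [AddCommGroup V] [Module K V]
    [AddCommGroup W] [Module K W] where
  bound : ℕ
  coeff : (k : ℕ) → MultilinearMap K (fun _ : Fin k => V) W

namespace PolyMap

variable {K V W : Type*} [CommRing K] [AddCommGroup V] [Module K V]
  [AddCommGroup W] [Module K W]

/-- The value `F (x)`. -/
def eval (F : PolyMap K V W) (x : V) : W :=
  ∑ k ∈ Finset.range F.bound, F.coeff k (fun _ => x)

/-- The formal differential `dF (x) v`, i.e. the coefficient of `ε` in `F (x + ε v)`. -/
def diff (F : PolyMap K V W) (x v : V) : W :=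
  ∑ k ∈ Finset.range F.bound, (F.coeff k).linearDeriv (fun _ => x) (fun _ => v)

end PolyMap

end PolynomialMaps

section SymmetricSpaces

/-- The data of an algebraic symmetric space realized inside a `K`-module `V`: a subset
`carrier` of a submodule `direction`, where `direction` is the tangent space at each point;
a product `mul x y = σ_x (y)`; and the extension `tangentMul` of this product to the points
`x + ε v` over the dual numbers, written as pairs `(x, v)`. -/
structure SymmetricSpaceData (K V : Type*) [CommRing K] [AddCommGroup V] [Module K V] where
  carrier : Set V
  direction : Submodule K V
  carrier_subset : carrier ⊆ direction
  mul : V → V → V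
  tangentMul : V × V → V × V → V × V

namespace SymmetricSpaceData

variable {K V W : Type*} [CommRing K] [AddCommGroup V] [Module K V]
  [AddCommGroup W] [Module K W]

/-- The axioms of a symmetric space: the set is stable under the product, the product is that
of a reflection space, the extension over the dual numbers is a map of tangent bundles over the
product, and the tangent map of `σ_x` at its fixed point `x` is `-id`. -/
structure IsSymmetricSpace (M : SymmetricSpaceData K V) : Prop where
  mul_mem : ∀ x ∈ M.carrier, ∀ y ∈ M.carrier, M.mul x y ∈ M.carrier
  fixed : ∀ x ∈ M.carrier, M.mul x x = x
  involutive : ∀ x ∈ M.carrier, ∀ y ∈ M.carrier, M.mul x (M.mul x y) = y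
  distrib : ∀ x ∈ M.carrier, ∀ y ∈ M.carrier, ∀ z ∈ M.carrier,
    M.mul x (M.mul y (M.mul x z)) = M.mul (M.mul x y) z
  tangent_mem : ∀ x ∈ M.carrier, ∀ y ∈ M.carrier, ∀ u ∈ M.direction, ∀ v ∈ M.direction,
    ∃ w ∈ M.direction, M.tangentMul (x, u) (y, v) = (M.mul x y, w)
  tangent_symm : ∀ x ∈ M.carrier, ∀ v ∈ M.direction, M.tangentMul (x, 0) (x, v) = (x, -v)

/-- The data induced on the intersection with a submodule. -/
def restrict (M : SymmetricSpaceData K V) (W : Submodule K V) : SymmetricSpaceData K V where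
  carrier := M.carrier ∩ W
  direction := M.direction ⊓ W
  carrier_subset := fun _ hx => ⟨M.carrier_subset hx.1, hx.2⟩
  mul := M.mul
  tangentMul := M.tangentMul

/-- The intersection with the submodule `W` is a symmetric subspace: it is stable under the
product, and it is a symmetric space for the induced structure, with tangent spaces the
intersections of the tangent spaces with `W`. -/
def IsSymmetricSubspace (M : SymmetricSpaceData K V) (W : Submodule K V) : Prop :=
  (M.restrict W).IsSymmetricSpace

/-- The flat symmetric space `σ_x (y) = 2 x - y` on a submodule. -/
def flat (W : Submodule K V) : SymmetricSpaceData K V where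
  carrier := W
  direction := W
  carrier_subset := fun _ hx => hx
  mul := fun x y => (2 : K) • x - y
  tangentMul := fun x y => (2 : K) • x - y

/-- An isomorphism of symmetric spaces: a polynomial bijection, with polynomial inverse, such
that also the tangent maps are inverse to each other, and which is compatible with the products
and with their extensions to the tangent bundles. -/
structure Iso (M : SymmetricSpaceData K V) (N : SymmetricSpaceData K W) where
  toFun : PolyMap K M.direction N.direction
  invFun : PolyMap K N.direction M.direction
  map_mem : ∀ x : M.direction, (x : V) ∈ M.carrier → (toFun.eval x : W) ∈ N.carrier
  inv_mem : ∀ y : N.direction, (y : W) ∈ N.carrier → (invFun.eval y : V) ∈ M.carrier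
  left_inv : ∀ x : M.direction, (x : V) ∈ M.carrier → invFun.eval (toFun.eval x) = x
  right_inv : ∀ y : N.direction, (y : W) ∈ N.carrier → toFun.eval (invFun.eval y) = y
  diff_left_inv : ∀ x : M.direction, (x : V) ∈ M.carrier → ∀ v,
    invFun.diff (toFun.eval x) (toFun.diff x v) = v
  diff_right_inv : ∀ y : N.direction, (y : W) ∈ N.carrier → ∀ v,
    toFun.diff (invFun.eval y) (invFun.diff y v) = v
  map_mul : ∀ x y z : M.direction, (x : V) ∈ M.carrier → (y : V) ∈ M.carrier →
    M.mul x y = z → N.mul (toFun.eval x) (toFun.eval y) = toFun.eval z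
  map_tangentMul : ∀ x y z u v w : M.direction, (x : V) ∈ M.carrier → (y : V) ∈ M.carrier →
    M.tangentMul (x, u) (y, v) = (↑z, ↑w) →
    N.tangentMul (toFun.eval x, toFun.diff x u) (toFun.eval y, toFun.diff y v) =
      (↑(toFun.eval z), ↑(toFun.diff z w))

end SymmetricSpaceData

end SymmetricSpaces

namespace UnitalJordanAlgebra

variable {K J : Type*} [CommRing K] [AddCommGroup J] [Module K J]

/-- The quadratic operator `U_x y = 2 x (x y) - (x x) y`. -/
def quad (A : UnitalJordanAlgebra K J) (x : J) : Module.End K J :=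
  (2 : K) • (A.mul x ∘ₗ A.mul x) - A.mul (A.mul x x)

/-- The set of invertible elements. -/
def invertibles (A : UnitalJordanAlgebra K J) : Set J := {x | IsUnit (A.quad x)}

/-- The Jordan inverse `U_x⁻¹ x` of an invertible element `x`. -/
noncomputable def inv (A : UnitalJordanAlgebra K J) (x : J) : J := Ring.inverse (A.quad x) x

/-- The product `U_x (y⁻¹)` on the invertible elements. -/
noncomputable def symMul (A : UnitalJordanAlgebra K J) (x y : J) : J := A.quad x (A.inv y)

/-- The scalar extension `J ⊕ ε J` by the dual numbers, regarded over `K`. -/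
def dual [Invertible (2 : K)] (A : UnitalJordanAlgebra K J) : UnitalJordanAlgebra K (J × J) where
  mul := dualBilin A.mul
  one := (A.one, 0)
  mul_comm x y := by
    simp only [dualBilin_apply, A.mul_comm x.1 y.1, A.mul_comm x.2 y.1, A.mul_comm x.1 y.2]
    rw [add_comm]
  one_mul x := by simp [dualBilin_apply, A.one_mul]
  jordan x y := by
    have h0 := A.jordan x.1 y.1
    have h1 := A.jordan x.1 y.2
    have h2 := A.jordan x.2 y.1
    have h3 := A.jordan (x.1 + x.2) y.1
    have h4 := A.jordan (x.1 - x.2) y.1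
    simp only [map_add, map_sub, LinearMap.add_apply, LinearMap.sub_apply] at h3 h4
    simp only [A.mul_comm x.2 x.1] at h3 h4
    simp only [dualBilin_apply, map_add, LinearMap.add_apply, A.mul_comm x.2 x.1, Prod.mk.injEq]
    refine ⟨h0, ?_⟩
    have key : (2 : K) • (A.mul x.2 (A.mul (A.mul x.1 x.1) y.1)
        + (A.mul x.1 (A.mul (A.mul x.1 x.2) y.1) + A.mul x.1 (A.mul (A.mul x.1 x.2) y.1)))
        = (2 : K) • (A.mul (A.mul x.1 x.2) (A.mul x.1 y.1)
          + A.mul (A.mul x.1 x.2) (A.mul x.1 y.1) + A.mul (A.mul x.1 x.1) (A.mul x.2 y.1)) := by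
      linear_combination (norm := module) h3 - h4 - (2 : K) • h2
    have key' := congrArg (fun t => (⅟2 : K) • t) key
    simp only [smul_smul, invOf_mul_self, one_smul] at key'
    linear_combination (norm := module) key' + h1

/-- The quadratic prehomogeneous symmetric space of invertible elements of a unital Jordan
algebra, an open part of the module `J`. -/
noncomputable def symmetricSpace [Invertible (2 : K)] (A : UnitalJordanAlgebra K J) :
    SymmetricSpaceData K J where
  carrier := A.invertibles
  direction := ⊤
  carrier_subset := fun _ _ => Submodule.mem_top
  mul := A.symMul
  tangentMul := A.dual.symMul

end UnitalJordanAlgebra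

namespace LinearJordanPair

variable {K Vp Vm : Type*} [CommRing K] [AddCommGroup Vp] [Module K Vp]
  [AddCommGroup Vm] [Module K Vm]

/-- The opposite pair `(V⁻, V⁺)`. -/
def swap (J : LinearJordanPair K Vp Vm) : LinearJordanPair K Vm Vp where
  Tp := J.Tm
  Tm := J.Tp
  symm_p := J.symm_m
  symm_m := J.symm_p
  jordan_p := J.jordan_m
  jordan_m := J.jordan_p

/-- The scalar extension `(V⁺ ⊕ ε V⁺, V⁻ ⊕ ε V⁻)` by the dual numbers, regarded over `K`. -/
def dual (J : LinearJordanPair K Vp Vm) : LinearJordanPair K (Vp × Vp) (Vm × Vm) where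
  Tp := dualTrilin J.Tp
  Tm := dualTrilin J.Tm
  symm_p x y z := by
    simp only [dualTrilin_apply, J.symm_p z.1, J.symm_p z.2, Prod.mk.injEq, true_and]
    abel
  symm_m x y z := by
    simp only [dualTrilin_apply, J.symm_m z.1, J.symm_m z.2, Prod.mk.injEq, true_and]
    abel
  jordan_p u v x y z := by
    simp only [dualTrilin_apply, map_add, LinearMap.add_apply, Prod.mk_add_mk, Prod.mk_sub_mk,
      Prod.mk.injEq]
    refine ⟨J.jordan_p .., ?_⟩
    rw [J.jordan_p u.2 v.1 x.1 y.1 z.1, J.jordan_p u.1 v.2 x.1 y.1 z.1,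
      J.jordan_p u.1 v.1 x.2 y.1 z.1, J.jordan_p u.1 v.1 x.1 y.2 z.1,
      J.jordan_p u.1 v.1 x.1 y.1 z.2]
    abel
  jordan_m u v x y z := by
    simp only [dualTrilin_apply, map_add, LinearMap.add_apply, Prod.mk_add_mk, Prod.mk_sub_mk,
      Prod.mk.injEq]
    refine ⟨J.jordan_m .., ?_⟩
    rw [J.jordan_m u.2 v.1 x.1 y.1 z.1, J.jordan_m u.1 v.2 x.1 y.1 z.1,
      J.jordan_m u.1 v.1 x.2 y.1 z.1, J.jordan_m u.1 v.1 x.1 y.2 z.1,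
      J.jordan_m u.1 v.1 x.1 y.1 z.2]
    abel

/-- The Peirce space `V_i⁺`: the eigenspace of `T⁺(e⁺, e⁻)` for the eigenvalue `i = 0, 1, 2`. -/
def peirce (J : LinearJordanPair K Vp Vm) (ep : Vp) (em : Vm) (i : Fin 3) : Submodule K Vp :=
  Module.End.eigenspace (J.Tp ep em) ((i : ℕ) : K)

theorem mem_peirce_two (J : LinearJordanPair K Vp Vm) (ep : Vp) (em : Vm) (x : Vp) :
    x ∈ J.peirce ep em 2 ↔ J.Tp ep em x = (2 : K) • x := by
  simp [peirce]

variable [Invertible (2 : K)]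

/-- The quadratic map `Q⁺(x) y = ½ T⁺(x, y, x)`; `J.swap.Q` is `Q⁻`. -/
def Q (J : LinearJordanPair K Vp Vm) (x : Vp) : Vm →ₗ[K] Vp := (⅟2 : K) • (J.Tp x).flip x

/-- The Bergman operator `B(x, y) = id - T⁺(x, y) + Q⁺(x) Q⁻(y)`. -/
def B (J : LinearJordanPair K Vp Vm) (x : Vp) (y : Vm) : Module.End K Vp :=
  1 - J.Tp x y + J.Q x ∘ₗ J.swap.Q y

/-- The quasi-inverse `x^y = B(x, y)⁻¹ (x - Q(x) y)`, for quasi-invertible `(x, y)`. -/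
noncomputable def quasiInverse (J : LinearJordanPair K Vp Vm) (x : Vp) (y : Vm) : Vp :=
  Ring.inverse (J.B x y) (x - J.Q x y)

/-- `U_a`: the set of `x ∈ V⁺` such that `(x, -a)` is quasi-invertible. -/
def quasiInvertibles (J : LinearJordanPair K Vp Vm) (a : Vm) : Set Vp :=
  {x | IsUnit (J.B x (-a))}

/-- The product of `U_a`: `μ(x, y) = 2 x + Q(x) a + B(x, -a) σ₀(y)`, where
`σ₀(y) = (-y)^a` is the symmetry at the origin. -/
noncomputable def symMul (J : LinearJordanPair K Vp Vm) (a : Vm) (x y : Vp) : Vp :=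
  (2 : K) • x + J.Q x a + J.B x (-a) (J.quasiInverse (-y) a)

/-- The symmetric space `U_a`, an open part of the module `V⁺`. -/
noncomputable def symmetricSpace (J : LinearJordanPair K Vp Vm) (a : Vm) :
    SymmetricSpaceData K Vp where
  carrier := J.quasiInvertibles a
  direction := ⊤
  carrier_subset := fun _ _ => Submodule.mem_top
  mul := J.symMul a
  tangentMul := J.dual.symMul (a, 0)

/-- `(ep, em)` is an idempotent of the Jordan pair. -/
def IsIdempotent (J : LinearJordanPair K Vp Vm) (ep : Vp) (em : Vm) : Prop :=
  J.Q ep em = ep ∧ J.swap.Q em ep = em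

theorem tp_idem (J : LinearJordanPair K Vp Vm) {ep : Vp} {em : Vm} (h : J.IsIdempotent ep em) :
    J.Tp ep em ep = (2 : K) • ep := by
  have h1 := congrArg (fun t => (2 : K) • t) h.1
  simpa [Q, smul_smul] using h1

theorem tm_idem (J : LinearJordanPair K Vp Vm) {ep : Vp} {em : Vm} (h : J.IsIdempotent ep em) :
    J.Tm em ep em = (2 : K) • em := by
  have h1 := congrArg (fun t => (2 : K) • t) h.2
  simpa [Q, swap, smul_smul] using h1

theorem tp_shift [Invertible (3 : K)] (J : LinearJordanPair K Vp Vm) (x : Vp) (a q : Vm) :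
    J.Tp x a (J.Tp x q x) = J.Tp x (J.Tm a x q) x := by
  have h1 := J.jordan_p x a x q x
  have h2 := J.jordan_p x q x a x
  rw [J.symm_p (J.Tp x a x) q x] at h1
  rw [J.symm_p (J.Tp x q x) a x, J.symm_m q x a] at h2
  have h3 : (3 : K) • J.Tp x a (J.Tp x q x) = (3 : K) • J.Tp x (J.Tm a x q) x := by
    linear_combination (norm := module) -h1 - (2 : K) • h2
  have h4 := congrArg (fun t => (⅟3 : K) • t) h3
  simpa only [smul_smul, invOf_mul_self, one_smul] using h4

theorem tp_jordan [Invertible (3 : K)] (J : LinearJordanPair K Vp Vm) (x y : Vp) (a : Vm) :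
    J.Tp x a (J.Tp (J.Tp x a x) a y) = J.Tp (J.Tp x a x) a (J.Tp x a y) := by
  have key : ∀ w, J.Tp (J.Tp x a x) a w =
      (2 : K) • J.Tp x a (J.Tp x a w) - J.Tp x (J.Tm a w a) x := by
    intro w
    have h := J.jordan_p w a x a x
    rw [J.symm_p (J.Tp x a x) a w, h, J.symm_p (J.Tp w a x) a x, J.symm_p w a x]
    module
  have hs : J.Tm a x (J.Tm a y a) = J.Tm a (J.Tp x a y) a := J.swap.tp_shift a x y
  rw [key, key, map_sub, map_smul, J.tp_shift, hs]

theorem tp_mem_peirce_two (J : LinearJordanPair K Vp Vm) {ep : Vp} {em : Vm}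
    (h : J.IsIdempotent ep em) {x y : Vp} (hx : x ∈ J.peirce ep em 2)
    (hy : y ∈ J.peirce ep em 2) : J.Tp x em y ∈ J.peirce ep em 2 := by
  rw [mem_peirce_two] at hx hy ⊢
  rw [J.jordan_p, hx, hy, J.tm_idem h]
  simp only [map_smul, LinearMap.smul_apply]
  module

/-- The unital Jordan algebra `V₂⁺` of an idempotent, with product `½ T⁺(x, e⁻, y)` and
unit element `e⁺`. -/
def peirceTwoAlgebra [Invertible (3 : K)] (J : LinearJordanPair K Vp Vm) {ep : Vp} {em : Vm}
    (h : J.IsIdempotent ep em) : UnitalJordanAlgebra K (J.peirce ep em 2) where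
  mul := LinearMap.mk₂ K
    (fun x y => ⟨(⅟2 : K) • J.Tp x em y,
      Submodule.smul_mem _ _ (J.tp_mem_peirce_two h x.2 y.2)⟩)
    (by intro a b c; ext; simp)
    (by intro r a b; ext; simp [smul_smul, mul_comm])
    (by intro a b c; ext; simp)
    (by intro r a b; ext; simp [smul_smul, mul_comm])
  one := ⟨ep, (J.mem_peirce_two ep em ep).2 (J.tp_idem h)⟩
  mul_comm x y := by
    ext
    simp [J.symm_p (x : Vp) em y]
  one_mul x := by
    ext
    simp [(J.mem_peirce_two ep em x).1 x.2, smul_smul]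
  jordan x y := by
    ext
    simp [smul_smul, J.tp_jordan]

end LinearJordanPair

set_option linter.unusedSectionVars false

/-! ### Triple identities and the homotope of an element of `V⁻`. -/

namespace LinearJordanPair

variable {K Vp Vm : Type*} [CommRing K] [Invertible (2 : K)] [AddCommGroup Vp] [Module K Vp]
  [AddCommGroup Vm] [Module K Vm] (J : LinearJordanPair K Vp Vm)

/-! Everything takes place in the homotope of `e⁻`, that is, on `V⁺` with the product `½ T(x, e⁻,
y)`. By `B_neg_apply`, `B(x, -e⁻)` involves only this product and has the shape `1 + 2 L_x + U_x` of
the operator `U_{1+x}`.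

Put `D = T(e⁺, e⁻)`. Then `D(D-1)(D-2) = 0` (`tp_idem_cubic`), which yields the Peirce decomposition
since 2 is invertible, and `D` takes a product of `V_i` and `V_j` to its multiple by `i + j - 2`. A
product whose predicted eigenvalue lies outside `{0, 1, 2}` vanishes. It follows that `V₀`
annihilates the homotope, while `V₁` multiplies `V₂` into `V₁` and `V₁` into `V₀`.

So `B(x, -e⁻)` is block triangular, with diagonal blocks `U_{x₂+e⁺}` on `V₂`, `T(x₂+e⁺, e⁻)` on `V₁`
and the identity on `V₀`. Since `V₂` acts on `V₁` by a special representation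
(`tp_quad_peirce_one`), the middle block is invertible as soon as the first is, and only the
condition on `x₂ + e⁺` remains (`isUnit_B_iff`).

On the base, translation by `e⁺` turns the product into `U_x y⁻¹` (`symMul_hom`), and the axioms
follow from the fundamental formula. On the fiber all products of three elements vanish, so the
product is `2x - y + ½ T(x-y, e⁻, x-y)` (`symMul_of_nilpotent`), which a quadratic change of
coordinates flattens. The tangent statements come from the same lemmas applied to the dual-number
extension. -/

theorem swap_Q_apply (x : Vm) (y : Vp) : J.swap.Q x y = (⅟2 : K) • J.Tm x y x := rfl

theorem Q_apply (x : Vp) (y : Vm) : J.Q x y = (⅟2 : K) • J.Tp x y x := rfl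

theorem tp_tp_left (x : Vp) (a b : Vm) (w : Vp) :
    J.Tp (J.Tp x a x) b w = (2 : K) • J.Tp x a (J.Tp x b w) - J.Tp x (J.Tm b w a) x := by
  have h := J.jordan_p w b x a x
  rw [J.symm_p (J.Tp x a x) b w, h, J.symm_p (J.Tp w b x) a x, J.symm_p w b x]
  module

theorem tm_comm_middle (a : Vm) (x : Vp) (b : Vm) :
    J.Tm (J.Tm a x a) x b = J.Tm a (J.Tp x a x) b := by
  have h := J.jordan_m a x a x b
  linear_combination (norm := module) -h

/-- The fundamental formula, in terms of the triple products. -/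
theorem tp_fundamental [Invertible (3 : K)] (x : Vp) (a b : Vm) :
    J.Tp (J.Tp x a x) b (J.Tp x a x) = J.Tp x (J.Tm a (J.Tp x b x) a) x := by
  -- By `tp_shift` both sides take the form `T(x, ·, x)`; what is left is an identity between the
  -- middle entries, supplied by `tp_tp_left` in the opposite pair.
  have h1 : J.Tm (J.Tm a x a) x b = (2 : K) • J.Tm a x (J.Tm a x b) - J.Tm a (J.Tp x b x) a :=
    J.swap.tp_tp_left a x x b
  rw [J.tm_comm_middle, J.symm_m a _ b] at h1
  rw [J.tp_tp_left, J.tp_shift, J.tp_shift, h1, J.symm_m b x a]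
  simp only [map_sub, map_smul, LinearMap.sub_apply, LinearMap.smul_apply]
  module

theorem Q_fundamental [Invertible (3 : K)] (x : Vp) (a b : Vm) :
    J.Q (J.Q x a) b = J.Q x (J.swap.Q a (J.Q x b)) := by
  simp only [Q_apply, map_smul, LinearMap.smul_apply, J.tp_fundamental]
  rfl

/-- Expanding the left side by the Jordan identity gives four times `T(x, q, x)` minus the left side
itself, by `tp_shift`. The lemma is used for the spectrum of `T(e⁺, e⁻)`, for its analogue on `V⁻`,
and for the differential of the inversion. -/
theorem tp_of_tp_eq_two_smul [Invertible (3 : K)] {x : Vp} {y : Vm}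
    (hxy : J.Tp x y x = (2 : K) • x) (q : Vm) :
    J.Tp x y (J.Tp x q x) = (2 : K) • J.Tp x q x := by
  have h1 := J.jordan_p x y x q x
  rw [← J.tp_shift, hxy] at h1
  simp only [map_smul, LinearMap.smul_apply] at h1
  have h2 := congrArg (fun t => (⅟2 : K) • t)
    (show (2 : K) • J.Tp x y (J.Tp x q x) = (2 : K) • ((2 : K) • J.Tp x q x) by
      linear_combination (norm := module) h1)
  simpa only [smul_smul, invOf_mul_self, one_smul, ← mul_assoc, one_mul] using h2

/-- `Q(x) Q(a)` is the quadratic operator of the homotope with product `½ T(x, a, y)`. -/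
theorem Q_swap_Q (x : Vp) (a : Vm) (z : Vp) :
    J.Q x (J.swap.Q a z) = (⅟2 : K) • J.Tp x a (J.Tp x a z)
      - (⅟2 * ⅟2 : K) • J.Tp (J.Tp x a x) a z := by
  rw [J.tp_tp_left, Q_apply, swap_Q_apply]
  simp only [map_smul, LinearMap.smul_apply, smul_sub, smul_smul, invOf_mul_self, mul_assoc,
    mul_one]
  module

/-- Eliminates all products with values in `V⁻`: the operator depends only on the homotope product,
so Peirce rules on `V⁺` suffice to compute it. -/
theorem B_neg_apply (x : Vp) (a : Vm) (z : Vp) :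
    J.B x (-a) z = z + J.Tp x a z + (⅟2 : K) • J.Tp x a (J.Tp x a z)
      - (⅟2 * ⅟2 : K) • J.Tp (J.Tp x a x) a z := by
  have h : J.swap.Q (-a) z = J.swap.Q a z := by simp [swap_Q_apply]
  simp only [B, LinearMap.add_apply, LinearMap.sub_apply, Module.End.one_apply,
    LinearMap.comp_apply, h, Q_swap_Q, map_neg, LinearMap.neg_apply]
  abel

theorem B_neg_neg (x : Vp) (a : Vm) : J.B (-x) a = J.B x (-a) := by
  ext z
  simp [B, Q_apply]

end LinearJordanPair

/-! ### Peirce decomposition and multiplication rules. -/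

namespace LinearJordanPair

variable {K Vp Vm : Type*} [CommRing K] [Invertible (2 : K)] [Invertible (3 : K)]
  [AddCommGroup Vp] [Module K Vp] [AddCommGroup Vm] [Module K Vm]
  (J : LinearJordanPair K Vp Vm) {ep : Vp} {em : Vm}

theorem IsIdempotent.swap {J : LinearJordanPair K Vp Vm} (h : J.IsIdempotent ep em) :
    J.swap.IsIdempotent em ep := ⟨h.2, h.1⟩

theorem tp_tm_idem (h : J.IsIdempotent ep em) (w : Vp) :
    J.Tp ep (J.Tm em w em) ep =
      (2 : K) • J.Tp ep em (J.Tp ep em w) - (2 : K) • J.Tp ep em w := by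
  have h1 := J.tp_tp_left ep em em w
  rw [J.tp_idem h] at h1
  simp only [map_smul, LinearMap.smul_apply] at h1
  linear_combination (norm := module) h1

theorem eq_zero_of_two_smul {V : Type*} [AddCommGroup V] [Module K V] {x : V}
    (hx : (2 : K) • x = 0) : x = 0 := by
  simpa [smul_smul] using congrArg (fun t => (⅟2 : K) • t) hx

theorem eq_zero_of_three_smul {V : Type*} [AddCommGroup V] [Module K V] {x : V}
    (hx : (3 : K) • x = 0) : x = 0 := by
  simpa [smul_smul] using congrArg (fun t => (⅟3 : K) • t) hx

/-- By `tp_tm_idem` the range of `2D² - 2D`, with `D = T(e⁺, e⁻)`, consists of elements `T(e⁺, q,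
e⁺)`, on which `D` is multiplication by 2. -/
theorem tp_idem_cubic (h : J.IsIdempotent ep em) (w : Vp) :
    J.Tp ep em (J.Tp ep em (J.Tp ep em w)) =
      (3 : K) • J.Tp ep em (J.Tp ep em w) - (2 : K) • J.Tp ep em w := by
  have h1 := J.tp_of_tp_eq_two_smul (J.tp_idem h) (J.Tm em w em)
  rw [J.tp_tm_idem h] at h1
  simp only [map_smul, map_sub] at h1
  refine sub_eq_zero.1 (eq_zero_of_two_smul (K := K) ?_)
  linear_combination (norm := module) h1

/-- The four values belong to the forbidden eigenvalues `3, -1, 4, -2` in this order; each is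
invertible because 2 and 3 are. -/
theorem eq_zero_of_eigen (h : J.IsIdempotent ep em) {w : Vp} {c : K}
    (hw : J.Tp ep em w = c • w)
    (hc : c * (c - 1) * (c - 2) = 6 ∨ c * (c - 1) * (c - 2) = -6 ∨
      c * (c - 1) * (c - 2) = 24 ∨ c * (c - 1) * (c - 2) = -24) : w = 0 := by
  have h1 := J.tp_idem_cubic h w
  simp only [hw, map_smul, smul_smul] at h1
  have h2 : (c * (c - 1) * (c - 2)) • w = 0 := by
    linear_combination (norm := module) h1
  have h6 : (6 : K) • w = 0 → w = 0 := fun h6 =>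
    eq_zero_of_two_smul (K := K) (eq_zero_of_three_smul (K := K) (by
      rw [smul_smul]; norm_num; exact h6))
  rcases hc with hc | hc | hc | hc <;> rw [hc] at h2
  · exact h6 h2
  · exact h6 (by simpa using h2)
  · exact h6 (eq_zero_of_two_smul (K := K) (eq_zero_of_two_smul (K := K) (by
      rw [smul_smul, smul_smul]; norm_num; exact h2)))
  · exact h6 (eq_zero_of_two_smul (K := K) (eq_zero_of_two_smul (K := K) (by
      rw [smul_smul, smul_smul]; norm_num; simpa using h2)))

theorem mem_peirce_zero (x : Vp) : x ∈ J.peirce ep em 0 ↔ J.Tp ep em x = 0 := by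
  simp [peirce]

theorem mem_peirce_one (x : Vp) : x ∈ J.peirce ep em 1 ↔ J.Tp ep em x = x := by
  simp [peirce]

/-- The derivation rule for `T(e⁺, e⁻)` on the homotope of `e⁻`. -/
theorem tp_idem_tp (h : J.IsIdempotent ep em) (x z : Vp) :
    J.Tp ep em (J.Tp x em z) =
      J.Tp (J.Tp ep em x) em z - (2 : K) • J.Tp x em z + J.Tp x em (J.Tp ep em z) := by
  rw [J.jordan_p, J.tm_idem h]
  simp

theorem exists_peirce (h : J.IsIdempotent ep em) (x : Vp) :
    ∃ x₂ ∈ J.peirce ep em 2, ∃ x₁ ∈ J.peirce ep em 1, ∃ x₀ ∈ J.peirce ep em 0,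
      x = x₂ + x₁ + x₀ := by
  have h3 := J.tp_idem_cubic h x
  -- Lagrange interpolation at `2, 1, 0`: the projections are `D(D-1)/2`, `D(2-D)` and
  -- `(D-1)(D-2)/2`.
  refine ⟨(⅟2 : K) • (J.Tp ep em (J.Tp ep em x) - J.Tp ep em x), ?_,
    (2 : K) • J.Tp ep em x - J.Tp ep em (J.Tp ep em x), ?_,
    x - (2 : K) • J.Tp ep em x + J.Tp ep em (J.Tp ep em x)
      - (⅟2 : K) • (J.Tp ep em (J.Tp ep em x) - J.Tp ep em x), ?_, by module⟩
  · rw [mem_peirce_two, smul_smul, mul_invOf_self, map_smul, map_sub, h3]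
    rw [show ∀ a b : Vp, (3 : K) • a - (2 : K) • b - a = (2 : K) • (a - b) by intros; module,
      smul_smul, invOf_mul_self]
  · rw [mem_peirce_one]
    simp only [map_sub, map_smul, h3]
    module
  · rw [mem_peirce_zero]
    simp only [map_add, map_sub, map_smul, h3]
    rw [show ∀ a b : Vp, (3 : K) • a - (2 : K) • b - a = (2 : K) • (a - b) by intros; module,
      smul_smul, invOf_mul_self]
    module

theorem peirce_indep {x₂ x₁ x₀ : Vp} (h2 : x₂ ∈ J.peirce ep em 2)
    (h1 : x₁ ∈ J.peirce ep em 1) (h0 : x₀ ∈ J.peirce ep em 0) (hs : x₂ + x₁ + x₀ = 0) :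
    x₂ = 0 ∧ x₁ = 0 ∧ x₀ = 0 := by
  rw [mem_peirce_two] at h2
  rw [mem_peirce_one] at h1
  rw [mem_peirce_zero] at h0
  have e1 := congrArg (J.Tp ep em) hs
  simp only [map_add, h2, h1, h0, map_zero] at e1
  have e2 := congrArg (J.Tp ep em) e1
  simp only [map_add, map_smul, h2, h1, map_zero] at e2
  have z2 : x₂ = 0 := eq_zero_of_two_smul (K := K) (by
    linear_combination (norm := module) e2 - e1)
  subst z2
  have z1 : x₁ = 0 := by simpa using e1
  subst z1
  exact ⟨rfl, rfl, by simpa using hs⟩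

/-- The element would be an eigenvector of `T(e⁻, e⁺)` with eigenvalue `2 - 1 + 2 = 3`. -/
theorem tm_idem_peirce_one (h : J.IsIdempotent ep em) {x : Vp} (hx : x ∈ J.peirce ep em 1) :
    J.Tm em x em = 0 := by
  rw [mem_peirce_one] at hx
  refine J.swap.eq_zero_of_eigen h.swap (c := 3) ?_ (by norm_num)
  change J.Tm em ep (J.Tm em x em) = _
  rw [J.jordan_m, hx, J.tm_idem h]
  simp only [map_smul, LinearMap.smul_apply]
  module

theorem tp_peirce_two_one (h : J.IsIdempotent ep em) {x z : Vp} (hx : x ∈ J.peirce ep em 2)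
    (hz : z ∈ J.peirce ep em 1) : J.Tp x em z ∈ J.peirce ep em 1 := by
  rw [mem_peirce_two] at hx
  rw [mem_peirce_one] at *
  rw [J.tp_idem_tp h, hx, hz]
  simp

theorem tp_peirce_one_one (h : J.IsIdempotent ep em) {x z : Vp} (hx : x ∈ J.peirce ep em 1)
    (hz : z ∈ J.peirce ep em 1) : J.Tp x em z ∈ J.peirce ep em 0 := by
  rw [mem_peirce_one] at hx hz
  rw [mem_peirce_zero, J.tp_idem_tp h, hx, hz]
  module

/-- Says that `Q(e⁺) Q(e⁻)` is the identity on `V₂`, so that an element of `V₂` can be written as a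
value of `Q(e⁺)`. -/
theorem tp_peirce_two_eq (h : J.IsIdempotent ep em) {z : Vp} (hz : z ∈ J.peirce ep em 2) :
    J.Tp ep (J.Tm em z em) ep = (4 : K) • z := by
  rw [mem_peirce_two] at hz
  rw [J.tp_tm_idem h, hz, map_smul, hz]
  module

theorem tp_peirce_zero (h : J.IsIdempotent ep em) {x : Vp} (hx : x ∈ J.peirce ep em 0)
    (z : Vp) : J.Tp x em z = 0 := by
  have hx' := (J.mem_peirce_zero x).1 hx
  obtain ⟨z2, h2, z1, h1, z0, h0, rfl⟩ := J.exists_peirce h z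
  have e0 : J.Tp x em z0 = 0 := by
    rw [mem_peirce_zero] at h0
    refine J.eq_zero_of_eigen h (c := -2) ?_ (by norm_num)
    rw [J.tp_idem_tp h, hx', h0]
    simp
  have e1 : J.Tp x em z1 = 0 := by
    rw [mem_peirce_one] at h1
    refine J.eq_zero_of_eigen h (c := -1) ?_ (by norm_num)
    rw [J.tp_idem_tp h, hx', h1]
    simp only [map_zero, LinearMap.zero_apply]
    module
  -- Here the predicted eigenvalue `0 + 2 - 2 = 0` is allowed, so `z2` is rewritten through `Q(e⁺)
  -- Q(e⁻)` and the Jordan identity is applied; the middle term vanishes because its eigenvalue in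
  -- `V⁻` would be 4.
  have e2 : J.Tp x em z2 = 0 := by
    have hw : J.Tm em x (J.Tm em z2 em) = 0 := by
      have hq : J.Tm em ep (J.Tm em z2 em) = (2 : K) • J.Tm em z2 em :=
        J.swap.tp_of_tp_eq_two_smul (J.tm_idem h) z2
      refine J.swap.eq_zero_of_eigen h.swap (c := 4) ?_ (by norm_num)
      change J.Tm em ep (J.Tm em x (J.Tm em z2 em)) = _
      rw [J.jordan_m, hx', J.tm_idem h, hq]
      simp only [map_smul, map_zero, LinearMap.smul_apply, LinearMap.zero_apply]
      module
    have e : J.Tp x em (J.Tp ep (J.Tm em z2 em) ep) = 0 := by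
      rw [J.jordan_p, J.symm_p x em ep, hx', hw]
      simp
    rw [J.tp_peirce_two_eq h h2, map_smul] at e
    refine eq_zero_of_two_smul (K := K) (eq_zero_of_two_smul (K := K) ?_)
    rw [smul_smul]; norm_num; exact e
  simp [e0, e1, e2]

theorem tp_peirce_zero_right (h : J.IsIdempotent ep em) {x : Vp} (hx : x ∈ J.peirce ep em 0)
    (z : Vp) : J.Tp z em x = 0 := by
  rw [J.symm_p, J.tp_peirce_zero h hx]

/-- With `φ(x) = T(x, e⁻, ·)` on `V₁`, this is `φ(x ∘ y) = ½ (φ(x) φ(y) + φ(y) φ(x))`. The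
correction term of the Jordan identity contains `T(e⁻, w, e⁻)`, which is zero for `w` in `V₁`. -/
theorem tp_tp_peirce_one (h : J.IsIdempotent ep em) (x y : Vp) {w : Vp}
    (hw : w ∈ J.peirce ep em 1) :
    J.Tp (J.Tp x em y) em w = J.Tp x em (J.Tp y em w) + J.Tp y em (J.Tp x em w) := by
  have e := J.jordan_p w em x em y
  rw [J.tm_idem_peirce_one h hw, J.symm_p w em, J.symm_p (J.Tp w em x), J.symm_p w em x,
    J.symm_p w em y] at e
  rw [e]
  simp only [map_zero, LinearMap.zero_apply]
  abel

end LinearJordanPair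

/-! ### Block form of the Bergman operator and the set `U_e`. -/

/-- A block triangular endomorphism, with identity lowest block, is bijective if and only if its
top block is, provided that the middle block is bijective whenever the top one is surjective. -/
theorem bijective_iff_of_block_triangular {K V : Type*} [CommRing K] [AddCommGroup V]
    [Module K V] (W₂ W₁ W₀ : Submodule K V)
    (hdec : ∀ x : V, ∃ x₂ ∈ W₂, ∃ x₁ ∈ W₁, ∃ x₀ ∈ W₀, x = x₂ + x₁ + x₀)
    (hind : ∀ x₂ ∈ W₂, ∀ x₁ ∈ W₁, ∀ x₀ ∈ W₀, x₂ + x₁ + x₀ = 0 → x₂ = 0 ∧ x₁ = 0 ∧ x₀ = 0)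
    (F : Module.End K V) (α : Module.End K W₂) (β : W₁ → V)
    (hβ : ∀ z, β z ∈ W₁)
    (h2 : ∀ z : W₂, ∃ r ∈ W₁, ∃ s ∈ W₀, F z = α z + r + s)
    (h1 : ∀ z : W₁, ∃ s ∈ W₀, F z = β z + s)
    (h0 : ∀ z ∈ W₀, F z = z)
    (hαβ : Function.Surjective α →
      (∀ z ∈ W₁, ∃ y, β y = z) ∧ ∀ z : W₁, β z = 0 → z = 0) :
    Function.Bijective F ↔ Function.Bijective α := by
  have uniq : ∀ x₂ ∈ W₂, ∀ x₁ ∈ W₁, ∀ x₀ ∈ W₀, ∀ y₂ ∈ W₂, x₂ + x₁ + x₀ = y₂ →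
      x₂ = y₂ ∧ x₁ = 0 ∧ x₀ = 0 := by
    intro x₂ m2 x₁ m1 x₀ m0 y₂ n2 e
    obtain ⟨a, b, c⟩ := hind (x₂ - y₂) (W₂.sub_mem m2 n2) x₁ m1 x₀ m0 (by rw [← sub_eq_zero.2 e]; abel)
    exact ⟨sub_eq_zero.1 a, b, c⟩
  have surj : Function.Surjective F → Function.Surjective α := by
    intro hF y
    obtain ⟨z, hz⟩ := hF y
    obtain ⟨z2, m2, z1, m1, z0, m0, rfl⟩ := hdec z
    obtain ⟨r, hr, s, hs, e2⟩ := h2 ⟨z2, m2⟩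
    obtain ⟨s', hs', e1⟩ := h1 ⟨z1, m1⟩
    refine ⟨⟨z2, m2⟩, Subtype.ext ?_⟩
    refine (uniq _ (α ⟨z2, m2⟩).2 (r + β ⟨z1, m1⟩) (W₁.add_mem hr (hβ _)) (s + s' + z0)
      (W₀.add_mem (W₀.add_mem hs hs') m0) y y.2 ?_).1
    rw [← hz, map_add, map_add, h0 z0 m0]
    simp only at e1 e2
    rw [e1, e2]
    abel
  constructor
  · intro hF
    obtain ⟨b1, -⟩ := hαβ (surj hF.2)
    refine ⟨?_, surj hF.2⟩
    rw [← LinearMap.ker_eq_bot, LinearMap.ker_eq_bot']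
    intro z hz
    obtain ⟨r, hr, s, hs, e2⟩ := h2 z
    -- An element of the kernel of `α` is completed, by components in `W₁` and `W₀` cancelling the
    -- off-diagonal terms, to an element of the kernel of `F`.
    obtain ⟨y, hy⟩ := b1 (-r) (W₁.neg_mem hr)
    obtain ⟨s', hs', e1⟩ := h1 y
    have e0 := h0 (-s - s') (W₀.sub_mem (W₀.neg_mem hs) hs')
    have : (z : V) + y + (-s - s') = 0 := hF.1 (by
      rw [map_add, map_add, e0, e1, e2, hy, hz, map_zero, ZeroMemClass.coe_zero]
      abel)
    exact Subtype.ext (hind _ z.2 _ y.2 _ (W₀.sub_mem (W₀.neg_mem hs) hs') this).1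
  · intro hα
    obtain ⟨b1, b2⟩ := hαβ hα.2
    constructor
    · rw [← LinearMap.ker_eq_bot, LinearMap.ker_eq_bot']
      intro z hz
      obtain ⟨z2, m2, z1, m1, z0, m0, rfl⟩ := hdec z
      obtain ⟨r, hr, s, hs, e2⟩ := h2 ⟨z2, m2⟩
      obtain ⟨s', hs', e1⟩ := h1 ⟨z1, m1⟩
      simp only at e1 e2
      have q2 := (uniq _ (α ⟨z2, m2⟩).2 (r + β ⟨z1, m1⟩) (W₁.add_mem hr (hβ _)) (s + s' + z0)
        (W₀.add_mem (W₀.add_mem hs hs') m0) 0 W₂.zero_mem (by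
          rw [← hz, map_add, map_add, h0 z0 m0, e1, e2]
          abel)).1
      have q2' : (⟨z2, m2⟩ : W₂) = 0 := hα.1 (by rw [map_zero]; exact Subtype.ext q2)
      have q2'' : z2 = 0 := congrArg Subtype.val q2'
      subst q2''
      rw [zero_add, map_add, h0 z0 m0, e1] at hz
      have q1 := (hind 0 W₂.zero_mem (β ⟨z1, m1⟩) (hβ _) (s' + z0) (W₀.add_mem hs' m0) (by
        rw [zero_add, ← add_assoc]; exact hz)).2.1
      have q1' : z1 = 0 := congrArg Subtype.val (b2 _ q1)
      subst q1'
      have : z0 = 0 := by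
        have e : s' = 0 := by
          rw [q1, map_zero, zero_add] at e1
          exact e1.symm
        rw [q1, e] at hz
        simpa using hz
      simp [this]
    · intro y
      obtain ⟨y2, m2, y1, m1, y0, m0, rfl⟩ := hdec y
      obtain ⟨z2, hz2⟩ := hα.2 ⟨y2, m2⟩
      obtain ⟨r, hr, s, hs, e2⟩ := h2 z2
      obtain ⟨z1, hz1⟩ := b1 (y1 - r) (W₁.sub_mem m1 hr)
      obtain ⟨s', hs', e1⟩ := h1 z1
      refine ⟨z2 + z1 + (y0 - s - s'), ?_⟩
      rw [map_add, map_add, h0 _ (W₀.sub_mem (W₀.sub_mem m0 hs) hs'), e1, e2, hz1, hz2]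
      abel

namespace LinearJordanPair

variable {K Vp Vm : Type*} [CommRing K] [Invertible (2 : K)] [Invertible (3 : K)]
  [AddCommGroup Vp] [Module K Vp] [AddCommGroup Vm] [Module K Vm]
  (J : LinearJordanPair K Vp Vm) {ep : Vp} {em : Vm}

theorem coe_peirceTwoAlgebra_mul (h : J.IsIdempotent ep em) (x y : J.peirce ep em 2) :
    ((J.peirceTwoAlgebra h).mul x y : Vp) = (⅟2 : K) • J.Tp x em y := rfl

theorem coe_peirceTwoAlgebra_one (h : J.IsIdempotent ep em) :
    ((J.peirceTwoAlgebra h).one : Vp) = ep := rfl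

theorem coe_peirceTwoAlgebra_quad (h : J.IsIdempotent ep em) (x z : J.peirce ep em 2) :
    ((J.peirceTwoAlgebra h).quad x z : Vp) =
      (⅟2 : K) • J.Tp x em (J.Tp x em z) - (⅟2 * ⅟2 : K) • J.Tp (J.Tp x em x) em z := by
  simp only [UnitalJordanAlgebra.quad, LinearMap.sub_apply, LinearMap.smul_apply,
    LinearMap.comp_apply, Submodule.coe_sub, Submodule.coe_smul, coe_peirceTwoAlgebra_mul,
    map_smul, smul_smul]
  rw [← mul_assoc, mul_invOf_self, one_mul]

theorem isInternal_peirce (h : J.IsIdempotent ep em) : DirectSum.IsInternal (J.peirce ep em) := by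
  refine DirectSum.isInternal_submodule_of_iSupIndep_of_iSup_eq_top ?_ ?_
  · rw [iSupIndep_def]
    intro i
    have hle : ∀ a b : Fin 3, (∀ j, j ≠ i → j = a ∨ j = b) →
        (⨆ j, ⨆ (_ : j ≠ i), J.peirce ep em j) ≤ J.peirce ep em a ⊔ J.peirce ep em b := by
      intro a b hab
      refine iSup₂_le fun j hj => ?_
      rcases hab j hj with rfl | rfl
      · exact le_sup_left
      · exact le_sup_right
    fin_cases i
    · refine Disjoint.mono_right (hle 1 2 (by decide)) (Submodule.disjoint_def.2 ?_)
      intro x hx hx'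
      obtain ⟨a, ha, b, hb, rfl⟩ := Submodule.mem_sup.1 hx'
      obtain ⟨rfl, rfl, -⟩ := J.peirce_indep hb ha (Submodule.neg_mem _ hx) (by abel)
      simp
    · refine Disjoint.mono_right (hle 0 2 (by decide)) (Submodule.disjoint_def.2 ?_)
      intro x hx hx'
      obtain ⟨a, ha, b, hb, rfl⟩ := Submodule.mem_sup.1 hx'
      obtain ⟨rfl, -, rfl⟩ := J.peirce_indep hb (Submodule.neg_mem _ hx) ha (by abel)
      simp
    · refine Disjoint.mono_right (hle 0 1 (by decide)) (Submodule.disjoint_def.2 ?_)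
      intro x hx hx'
      obtain ⟨a, ha, b, hb, rfl⟩ := Submodule.mem_sup.1 hx'
      obtain ⟨-, rfl, rfl⟩ := J.peirce_indep (Submodule.neg_mem _ hx) hb ha (by abel)
      simp
  · rw [eq_top_iff]
    rintro x -
    obtain ⟨x2, h2, x1, h1, x0, h0, rfl⟩ := J.exists_peirce h x
    exact Submodule.add_mem _ (Submodule.add_mem _ (Submodule.mem_iSup_of_mem 2 h2)
      (Submodule.mem_iSup_of_mem 1 h1)) (Submodule.mem_iSup_of_mem 0 h0)

/-- On `V₁` the operators `T(x, e⁻)`, `x ∈ V₂`, satisfy `φ(U_t s) = φ(t) φ(s) φ(t)`. -/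
theorem tp_quad_peirce_one (h : J.IsIdempotent ep em) (t s : J.peirce ep em 2) {w : Vp}
    (hw : w ∈ J.peirce ep em 1) :
    J.Tp ((J.peirceTwoAlgebra h).quad t s : Vp) em w =
      J.Tp t em (J.Tp s em (J.Tp t em w)) := by
  have m : ∀ x ∈ J.peirce ep em 2, J.Tp x em w ∈ J.peirce ep em 1 :=
    fun x hx => J.tp_peirce_two_one h hx hw
  have e := fun x y => J.tp_tp_peirce_one h x y hw
  rw [coe_peirceTwoAlgebra_quad]
  simp only [map_sub, map_smul, LinearMap.sub_apply, LinearMap.smul_apply, e,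
    J.tp_tp_peirce_one h _ _ (m s s.2), J.tp_tp_peirce_one h _ _ (m t t.2), map_add]
  have hh : ∀ x : Vp, (⅟2 : K) • x + (⅟2 : K) • x = x := by
    intro x; rw [← add_smul, ← two_mul, mul_invOf_self, one_smul]
  have hh' : ∀ x : Vp, (⅟2 * ⅟2 : K) • x + (⅟2 * ⅟2 : K) • x = (⅟2 : K) • x := by
    intro x; rw [← add_smul, ← two_mul, ← mul_assoc, mul_invOf_self, one_mul]
  linear_combination (norm := module) hh (J.Tp t em (J.Tp s em (J.Tp t em w)))
    - hh' (J.Tp t em (J.Tp t em (J.Tp s em w))) - hh' (J.Tp s em (J.Tp t em (J.Tp t em w)))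

/-- If `U_t s = 1`, then `φ(t) φ(s) φ(t) = φ(1) = id` on `V₁`, so `φ(t)` has both a right and a left
inverse. -/
theorem bijective_tp_peirce_one (h : J.IsIdempotent ep em) (t : J.peirce ep em 2)
    (ht : Function.Surjective ((J.peirceTwoAlgebra h).quad t)) :
    (∀ z ∈ J.peirce ep em 1, ∃ y : J.peirce ep em 1, J.Tp t em y = z) ∧
      ∀ z : J.peirce ep em 1, J.Tp t em z = 0 → z = 0 := by
  obtain ⟨s, hs⟩ := ht (J.peirceTwoAlgebra h).one
  have key : ∀ w ∈ J.peirce ep em 1, J.Tp t em (J.Tp s em (J.Tp t em w)) = w := by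
    intro w hw
    rw [← J.tp_quad_peirce_one h t s hw, hs, coe_peirceTwoAlgebra_one]
    exact (J.mem_peirce_one w).1 hw
  constructor
  · intro z hz
    exact ⟨⟨J.Tp s em (J.Tp t em z), J.tp_peirce_two_one h s.2 (J.tp_peirce_two_one h t.2 hz)⟩,
      key z hz⟩
  · intro z hz
    have := key z z.2
    rw [hz, map_zero, map_zero] at this
    exact Subtype.ext this.symm

theorem quad_add_one_apply {A : Type*} [AddCommGroup A] [Module K A]
    (𝔸 : UnitalJordanAlgebra K A) (x z : A) :
    𝔸.quad (x + 𝔸.one) z = z + (2 : K) • 𝔸.mul x z + 𝔸.quad x z := by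
  simp only [UnitalJordanAlgebra.quad, LinearMap.sub_apply, LinearMap.smul_apply,
    LinearMap.comp_apply, map_add, LinearMap.add_apply, 𝔸.one_mul, 𝔸.mul_comm x 𝔸.one]
  module

/-- The components `x₀` and `x₁` contribute nothing to the diagonal blocks: `x₀` acts by zero, and
products with `x₁` lower the Peirce index. -/
theorem isUnit_B_iff (h : J.IsIdempotent ep em) {x₀ x₁ : Vp} (h0 : x₀ ∈ J.peirce ep em 0)
    (h1 : x₁ ∈ J.peirce ep em 1) (x₂ : J.peirce ep em 2) :
    IsUnit (J.B (x₀ + x₁ + x₂) (-em)) ↔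
      IsUnit ((J.peirceTwoAlgebra h).quad (x₂ + (J.peirceTwoAlgebra h).one)) := by
  rw [Module.End.isUnit_iff, Module.End.isUnit_iff]
  have z0 : ∀ y, J.Tp x₀ em y = 0 := J.tp_peirce_zero h h0
  have z0' : ∀ y, J.Tp y em x₀ = 0 := J.tp_peirce_zero_right h h0
  have c11 := fun {a b : Vp} => J.tp_peirce_one_one h (x := a) (z := b)
  have c21 := fun {a b : Vp} => J.tp_peirce_two_one h (x := a) (z := b)
  have c12 : ∀ {a b : Vp}, a ∈ J.peirce ep em 1 → b ∈ J.peirce ep em 2 →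
      J.Tp a em b ∈ J.peirce ep em 1 := by
    intro a b ha hb
    rw [J.symm_p]
    exact J.tp_peirce_two_one h hb ha
  have c22 := fun {a b : Vp} => J.tp_mem_peirce_two h (x := a) (y := b)
  have k0 : ∀ {a b : Vp}, a ∈ J.peirce ep em 0 → J.Tp a em b = 0 :=
    fun ha => J.tp_peirce_zero h ha _
  have k0' : ∀ {a b : Vp}, b ∈ J.peirce ep em 0 → J.Tp a em b = 0 :=
    fun ha => J.tp_peirce_zero_right h ha _
  refine bijective_iff_of_block_triangular (J.peirce ep em 2) (J.peirce ep em 1)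
    (J.peirce ep em 0) (J.exists_peirce h) (fun _ h2 _ h1 _ h0 => J.peirce_indep h2 h1 h0) _ _
    (fun z => J.Tp (x₂ + (J.peirceTwoAlgebra h).one : J.peirce ep em 2) em z)
    (fun z => c21 (Submodule.coe_mem _) z.2) ?_ ?_ ?_
    (fun hs => J.bijective_tp_peirce_one h _ hs)
  · intro z
    refine ⟨J.Tp x₁ em z + (⅟2 : K) • (J.Tp x₂ em (J.Tp x₁ em z) + J.Tp x₁ em (J.Tp x₂ em z))
      - (⅟2 * ⅟2 : K) • (J.Tp (J.Tp x₂ em x₁) em z + J.Tp (J.Tp x₁ em x₂) em z), ?_,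
      (⅟2 : K) • J.Tp x₁ em (J.Tp x₁ em z), ?_, ?_⟩
    · exact Submodule.sub_mem _ (Submodule.add_mem _ (c12 h1 z.2)
        (Submodule.smul_mem _ _ (Submodule.add_mem _ (c21 x₂.2 (c12 h1 z.2))
          (c12 h1 (c22 x₂.2 z.2)))))
        (Submodule.smul_mem _ _ (Submodule.add_mem _ (c12 (c21 x₂.2 h1) z.2)
          (c12 (c12 h1 x₂.2) z.2)))
    · exact Submodule.smul_mem _ _ (c11 h1 (c12 h1 z.2))
    · rw [B_neg_apply, quad_add_one_apply]
      simp only [Submodule.coe_add, Submodule.coe_smul, coe_peirceTwoAlgebra_quad,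
        coe_peirceTwoAlgebra_mul, smul_smul, mul_invOf_self, map_add, LinearMap.add_apply, z0,
        z0', k0 (c11 h1 h1), map_zero, LinearMap.zero_apply]
      module
  · intro z
    refine ⟨J.Tp x₁ em z + (⅟2 : K) • J.Tp x₁ em (J.Tp x₂ em z)
      - (⅟2 * ⅟2 : K) • (J.Tp (J.Tp x₂ em x₁) em z + J.Tp (J.Tp x₁ em x₂) em z), ?_, ?_⟩
    · exact Submodule.sub_mem _ (Submodule.add_mem _ (c11 h1 z.2)
        (Submodule.smul_mem _ _ (c11 h1 (c21 x₂.2 z.2))))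
        (Submodule.smul_mem _ _ (Submodule.add_mem _ (c11 (c21 x₂.2 h1) z.2)
          (c11 (c12 h1 x₂.2) z.2)))
    · have hz := (J.mem_peirce_one (z : Vp)).1 z.2
      -- On `V₁` the two quadratic terms in `x₂` cancel, which is why the middle block is linear in
      -- `x₂`.
      have hq : (⅟2 * ⅟2 : K) • J.Tp (J.Tp x₂ em x₂) em z =
          (⅟2 : K) • J.Tp x₂ em (J.Tp x₂ em z) := by
        rw [J.tp_tp_peirce_one h _ _ z.2, ← two_smul K, smul_smul, mul_assoc, invOf_mul_self,
          mul_one]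
      rw [B_neg_apply]
      simp only [Submodule.coe_add, coe_peirceTwoAlgebra_one, map_add, LinearMap.add_apply, z0,
        z0', k0 (c11 h1 h1), k0' (c11 h1 z.2), map_zero, LinearMap.zero_apply, hz, smul_add, hq]
      module
  · intro z hz
    rw [B_neg_apply]
    simp [k0' hz]

theorem quasiInvertibles_eq (h : J.IsIdempotent ep em) :
    J.quasiInvertibles em =
      {x | ∃ x₀ ∈ J.peirce ep em 0, ∃ x₁ ∈ J.peirce ep em 1, ∃ x₂ : J.peirce ep em 2,
        x = x₀ + x₁ + x₂ ∧
          x₂ + (J.peirceTwoAlgebra h).one ∈ (J.peirceTwoAlgebra h).invertibles} := by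
  ext x
  constructor
  · intro hx
    obtain ⟨x2, h2, x1, h1, x0, h0, rfl⟩ := J.exists_peirce h x
    have e : x2 + x1 + x0 = x0 + x1 + x2 := by abel
    refine ⟨x0, h0, x1, h1, ⟨x2, h2⟩, e, (J.isUnit_B_iff h h0 h1 ⟨x2, h2⟩).1 ?_⟩
    rw [← e]
    exact hx
  · rintro ⟨x0, h0, x1, h1, x2, rfl, hx⟩
    exact (J.isUnit_B_iff h h0 h1 x2).2 hx

theorem coe_mem_quasiInvertibles_iff (h : J.IsIdempotent ep em) (x : J.peirce ep em 2) :
    (x : Vp) ∈ J.quasiInvertibles em ↔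
      x + (J.peirceTwoAlgebra h).one ∈ (J.peirceTwoAlgebra h).invertibles := by
  have := J.isUnit_B_iff h (Submodule.zero_mem _) (Submodule.zero_mem _) x
  rw [zero_add, zero_add] at this
  exact this

theorem quasiInvertibles_inter_peirce_two (h : J.IsIdempotent ep em) :
    J.quasiInvertibles em ∩ J.peirce ep em 2 =
      (fun z : J.peirce ep em 2 => (z : Vp) - ep) '' (J.peirceTwoAlgebra h).invertibles := by
  ext x
  constructor
  · rintro ⟨hx, h2⟩
    lift x to J.peirce ep em 2 using h2
    refine (Set.mem_image _ _ _).2 ⟨x + (J.peirceTwoAlgebra h).one,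
      (J.coe_mem_quasiInvertibles_iff h x).1 hx, ?_⟩
    rw [Submodule.coe_add, coe_peirceTwoAlgebra_one, add_sub_cancel_right]
  · rintro ⟨z, hz, rfl⟩
    have := (J.coe_mem_quasiInvertibles_iff h (z - (J.peirceTwoAlgebra h).one)).2
    rw [sub_add_cancel] at this
    exact ⟨this hz, Submodule.sub_mem _ z.2 (J.peirceTwoAlgebra h).one.2⟩

theorem fiber_subset_quasiInvertibles (h : J.IsIdempotent ep em) :
    ((J.peirce ep em 1 ⊔ J.peirce ep em 0 : Submodule K Vp) : Set Vp) ⊆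
      J.quasiInvertibles em := by
  intro x hx
  obtain ⟨x1, h1, x0, h0, rfl⟩ := Submodule.mem_sup.1 hx
  have := (J.isUnit_B_iff h h0 h1 0).2 (by
    convert isUnit_one
    ext z : 1
    rw [quad_add_one_apply]
    simp [UnitalJordanAlgebra.quad])
  rw [show x1 + x0 = x0 + x1 + (0 : J.peirce ep em 2) by simp [add_comm]]
  exact this

end LinearJordanPair

/-! ### Polynomial maps of degree at most two. -/

namespace PolyMap

variable {K V W : Type*} [CommRing K] [AddCommGroup V] [Module K V]
  [AddCommGroup W] [Module K W]

/-- The polynomial map `x ↦ c + l (x) + b (x, x)`. -/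
noncomputable def quadratic (c : W) (l : V →ₗ[K] W) (b : V →ₗ[K] V →ₗ[K] W) :
    PolyMap K V W where
  bound := 3
  coeff
    | 0 => MultilinearMap.constOfIsEmpty K _ c
    | 1 => MultilinearMap.ofSubsingleton K V W 0 l
    | 2 => LinearMap.uncurryLeft
        ((MultilinearMap.ofSubsingletonₗ K K V W (0 : Fin 1)).toLinearMap ∘ₗ b)
    | _ + 3 => 0

theorem eval_quadratic (c : W) (l : V →ₗ[K] W) (b : V →ₗ[K] V →ₗ[K] W) (x : V) :
    (quadratic c l b).eval x = c + l x + b x x := by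
  simp [quadratic, eval, Finset.sum_range_succ, Fin.tail]

theorem diff_quadratic (c : W) (l : V →ₗ[K] W) (b : V →ₗ[K] V →ₗ[K] W) (x v : V) :
    (quadratic c l b).diff x v = l v + b v x + b x v := by
  simp [quadratic, diff, Finset.sum_range_succ, MultilinearMap.linearDeriv_apply, Fin.sum_univ_two,
    Fin.tail, add_assoc]

end PolyMap

/-! ### Inverse operators and triangular operators over the dual numbers. -/

theorem Ring.inverse_end_apply_eq {K V : Type*} [CommRing K] [AddCommGroup V] [Module K V]
    {F : Module.End K V} (hF : IsUnit F) {p q : V} (h : F p = q) : Ring.inverse F q = p := by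
  rw [← h, ← Module.End.mul_apply, Ring.inverse_mul_cancel F hF, Module.End.one_apply]

theorem Ring.end_apply_inverse {K V : Type*} [CommRing K] [AddCommGroup V] [Module K V]
    {F : Module.End K V} (hF : IsUnit F) (q : V) : F (Ring.inverse F q) = q := by
  rw [← Module.End.mul_apply, Ring.mul_inverse_cancel F hF, Module.End.one_apply]

/-- Both diagonal blocks are `G`, so invertibility over the dual numbers is decided modulo `ε`; the
off-diagonal `N` may be any function. -/
theorem isUnit_of_dual_triangular {K V : Type*} [CommRing K] [AddCommGroup V] [Module K V]
    {F : Module.End K (V × V)} {G : Module.End K V} {N : V → V}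
    (hF : ∀ z, F z = (G z.1, G z.2 + N z.1)) (hG : IsUnit G) : IsUnit F := by
  rw [Module.End.isUnit_iff] at hG ⊢
  constructor
  · intro x y hxy
    rw [hF, hF, Prod.mk.injEq] at hxy
    have h1 := hG.1 hxy.1
    exact Prod.ext h1 (hG.1 (by simpa [h1] using hxy.2))
  · intro y
    obtain ⟨p, hp⟩ := hG.2 y.1
    obtain ⟨q, hq⟩ := hG.2 (y.2 - N p)
    exact ⟨(p, q), by rw [hF, hp, hq, sub_add_cancel]⟩

/-! ### The symmetric space of invertible elements. -/

namespace UnitalJordanAlgebra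

variable {K A : Type*} [CommRing K] [AddCommGroup A] [Module K A] (𝔸 : UnitalJordanAlgebra K A)

theorem quad_apply (x z : A) :
    𝔸.quad x z = (2 : K) • 𝔸.mul x (𝔸.mul x z) - 𝔸.mul (𝔸.mul x x) z := rfl

/-- The differential of `x ↦ U_x z` in direction `v`. -/
def quadDiff (x v z : A) : A :=
  (2 : K) • (𝔸.mul x (𝔸.mul v z) + 𝔸.mul v (𝔸.mul x z) - 𝔸.mul (𝔸.mul x v) z)

theorem dual_quad_apply [Invertible (2 : K)] (x v : A) (z : A × A) :
    𝔸.dual.quad (x, v) z = (𝔸.quad x z.1, 𝔸.quad x z.2 + 𝔸.quadDiff x v z.1) := by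
  simp only [quad_apply, dual, dualBilin_apply, quadDiff, map_add, LinearMap.add_apply,
    𝔸.mul_comm v x]
  ext
  · rfl
  · simp only [Prod.snd_sub, Prod.smul_snd]
    module

theorem quad_inv_apply {x : A} (hx : x ∈ 𝔸.invertibles) : 𝔸.quad x (𝔸.inv x) = x :=
  Ring.end_apply_inverse hx x

theorem dual_mem_invertibles [Invertible (2 : K)] {x : A} (hx : x ∈ 𝔸.invertibles) (v : A) :
    (x, v) ∈ 𝔸.dual.invertibles :=
  isUnit_of_dual_triangular (𝔸.dual_quad_apply x v) hx

/-- The second component is the result of differentiating `U_x (x⁻¹) = x` and solving for the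
derivative of the inverse. -/
theorem dual_inv [Invertible (2 : K)] {x : A} (hx : x ∈ 𝔸.invertibles) (v : A) :
    𝔸.dual.inv (x, v) =
      (𝔸.inv x, Ring.inverse (𝔸.quad x) (v - 𝔸.quadDiff x v (𝔸.inv x))) := by
  refine Ring.inverse_end_apply_eq (𝔸.dual_mem_invertibles hx v) ?_
  rw [dual_quad_apply, quad_inv_apply 𝔸 hx, Ring.end_apply_inverse hx, sub_add_cancel]

theorem dual_symMul_fst [Invertible (2 : K)] (x u : A) {y : A} (hy : y ∈ 𝔸.invertibles) (v : A) :
    (𝔸.dual.symMul (x, u) (y, v)).1 = 𝔸.symMul x y := by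
  rw [symMul, dual_inv 𝔸 hy, dual_quad_apply, symMul]

/-- The fundamental formula `hU` at `U_x (x⁻¹) = x` reads `U_x U_{x⁻¹} U_x = U_x`, and `U_x` can be
cancelled on both sides. -/
theorem quad_inv
    (hU : ∀ x y, 𝔸.quad (𝔸.quad x y) = 𝔸.quad x * 𝔸.quad y * 𝔸.quad x)
    {x : A} (hx : x ∈ 𝔸.invertibles) :
    𝔸.quad (𝔸.inv x) = Ring.inverse (𝔸.quad x) := by
  have h := hU x (𝔸.inv x)
  rw [quad_inv_apply 𝔸 hx] at h
  have h1 := Ring.mul_inverse_cancel _ hx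
  have h2 := Ring.inverse_mul_cancel _ hx
  calc 𝔸.quad (𝔸.inv x) = (Ring.inverse (𝔸.quad x) * 𝔸.quad x) * 𝔸.quad (𝔸.inv x) *
        (𝔸.quad x * Ring.inverse (𝔸.quad x)) := by rw [h1, h2, _root_.one_mul, mul_one]
    _ = Ring.inverse (𝔸.quad x) * (𝔸.quad x * 𝔸.quad (𝔸.inv x) * 𝔸.quad x) *
        Ring.inverse (𝔸.quad x) := by simp only [mul_assoc]
    _ = Ring.inverse (𝔸.quad x) := by rw [← h, h2, _root_.one_mul]

theorem quad_symMul
    (hU : ∀ x y, 𝔸.quad (𝔸.quad x y) = 𝔸.quad x * 𝔸.quad y * 𝔸.quad x)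
    {x y : A} (hy : y ∈ 𝔸.invertibles) :
    𝔸.quad (𝔸.symMul x y) = 𝔸.quad x * Ring.inverse (𝔸.quad y) * 𝔸.quad x := by
  rw [symMul, hU, quad_inv 𝔸 hU hy]

theorem symMul_mem
    (hU : ∀ x y, 𝔸.quad (𝔸.quad x y) = 𝔸.quad x * 𝔸.quad y * 𝔸.quad x)
    {x y : A} (hx : x ∈ 𝔸.invertibles) (hy : y ∈ 𝔸.invertibles) :
    𝔸.symMul x y ∈ 𝔸.invertibles := by
  change IsUnit _
  rw [quad_symMul 𝔸 hU hy]
  exact (IsUnit.mul hx (IsUnit.ringInverse hy)).mul hx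

theorem inv_symMul
    (hU : ∀ x y, 𝔸.quad (𝔸.quad x y) = 𝔸.quad x * 𝔸.quad y * 𝔸.quad x)
    {x y : A} (hx : x ∈ 𝔸.invertibles) (hy : y ∈ 𝔸.invertibles) :
    𝔸.inv (𝔸.symMul x y) = Ring.inverse (𝔸.quad x) y := by
  refine Ring.inverse_end_apply_eq (𝔸.symMul_mem hU hx hy) ?_
  rw [quad_symMul 𝔸 hU hy, Module.End.mul_apply, Module.End.mul_apply,
    Ring.end_apply_inverse hx]
  rfl

/-- In the distributive law both sides are `U_x U_y⁻¹ U_x z⁻¹`. By `hdiff` the differential of the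
inversion at `x` is `v ↦ U_x⁻¹ (v - 2v)`, hence `-id` after applying `U_x`. -/
theorem isSymmetricSpace [Invertible (2 : K)]
    (hU : ∀ x y, 𝔸.quad (𝔸.quad x y) = 𝔸.quad x * 𝔸.quad y * 𝔸.quad x)
    (hdiff : ∀ x ∈ 𝔸.invertibles, ∀ v, 𝔸.quadDiff x v (𝔸.inv x) = (2 : K) • v) :
    𝔸.symmetricSpace.IsSymmetricSpace where
  mul_mem _ hx _ hy := 𝔸.symMul_mem hU hx hy
  fixed _ hx := 𝔸.quad_inv_apply hx
  involutive x hx y hy := by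
    change 𝔸.quad x (𝔸.inv (𝔸.symMul x y)) = y
    rw [inv_symMul 𝔸 hU hx hy, Ring.end_apply_inverse hx]
  distrib x hx y hy z hz := by
    change 𝔸.quad x (𝔸.inv (𝔸.symMul y (𝔸.symMul x z))) =
      𝔸.quad (𝔸.symMul x y) (𝔸.inv z)
    rw [inv_symMul 𝔸 hU hy (𝔸.symMul_mem hU hx hz), quad_symMul 𝔸 hU hy]
    rfl
  tangent_mem x _ y hy u _ v _ :=
    ⟨(𝔸.dual.symMul (x, u) (y, v)).2, Submodule.mem_top,
      Prod.ext (𝔸.dual_symMul_fst x u hy v) rfl⟩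
  tangent_symm x hx v _ := by
    change 𝔸.dual.quad (x, 0) (𝔸.dual.inv (x, v)) = (x, -v)
    rw [dual_inv 𝔸 hx, hdiff x hx, dual_quad_apply, quad_inv_apply 𝔸 hx,
      Ring.end_apply_inverse hx]
    simp only [quadDiff, map_zero, LinearMap.zero_apply, Prod.mk.injEq, true_and]
    module

end UnitalJordanAlgebra

/-! ### The base: translation by `e⁺` onto the invertible elements of `V₂`. -/

namespace LinearJordanPair

variable {K Vp Vm : Type*} [CommRing K] [Invertible (2 : K)]
  [AddCommGroup Vp] [Module K Vp] [AddCommGroup Vm] [Module K Vm]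
  (J : LinearJordanPair K Vp Vm)

theorem isUnit_dual_B {a : Vm} {x : Vp} (hx : IsUnit (J.B x (-a))) (v : Vp) :
    IsUnit (J.dual.B (x, v) (-(a, 0))) := by
  refine isUnit_of_dual_triangular (G := J.B x (-a)) (N := fun z => J.Tp v a z
    + (⅟2 : K) • (J.Tp v a (J.Tp x a z) + J.Tp x a (J.Tp v a z))
    - (⅟2 * ⅟2 : K) • (J.Tp (J.Tp v a x) a z + J.Tp (J.Tp x a v) a z)) (fun z => ?_) hx
  rw [B_neg_apply, B_neg_apply, B_neg_apply]
  simp only [dual, dualTrilin_apply, map_zero, LinearMap.zero_apply, add_zero, map_add,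
    LinearMap.add_apply]
  ext
  · rfl
  · simp only [Prod.snd_add, Prod.snd_sub, Prod.smul_snd]
    module

section Hom

variable {A : Type*} [AddCommGroup A] [Module K A] (𝔸 : UnitalJordanAlgebra K A) (a : Vm)
  (φ : A →ₗ[K] Vp)

/-- An abstract homomorphism `φ` serves both the inclusion of `V₂` and its dual-number extension, so
that the product and its tangent extension need only one computation. -/
theorem B_hom_apply
    (hφ : ∀ x y, φ (𝔸.mul x y) = (⅟2 : K) • J.Tp (φ x) a (φ y)) (t p : A) :
    J.B (φ t) (-a) (φ p) = φ (𝔸.quad (t + 𝔸.one) p) := by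
  simp only [B_neg_apply, UnitalJordanAlgebra.quad_apply, map_add, LinearMap.add_apply, 𝔸.one_mul,
    𝔸.mul_comm t 𝔸.one, map_sub, map_smul, hφ, LinearMap.smul_apply, smul_add, smul_smul,
    mul_invOf_self, mul_invOf_cancel_left', one_smul]
  have hh : ∀ x : Vp, (⅟2 : K) • x + (⅟2 : K) • x = x := by
    intro x; rw [← add_smul, ← two_mul, mul_invOf_self, one_smul]
  linear_combination (norm := module) hh (J.Tp (φ t) a (φ p))

/-- A homomorphism of a unital Jordan algebra into the homotope of `a` turns the product of
`U_a` into the product of the invertible elements, translated by the unit. -/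
theorem symMul_hom
    (hφ : ∀ x y, φ (𝔸.mul x y) = (⅟2 : K) • J.Tp (φ x) a (φ y))
    {s t : A} (hs : IsUnit (J.B (φ s) (-a)))
    (hs' : s + 𝔸.one ∈ 𝔸.invertibles) :
    J.symMul a (φ t) (φ s) = φ (𝔸.symMul (t + 𝔸.one) (s + 𝔸.one)) - φ 𝔸.one := by
  have hsq : ∀ r, J.Q (φ r) a = φ (𝔸.mul r r) := fun r => by rw [hφ, Q_apply]
  have hone : ∀ r, 𝔸.quad (r + 𝔸.one) 𝔸.one = 𝔸.one + (2 : K) • r + 𝔸.mul r r := by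
    intro r
    simp only [UnitalJordanAlgebra.quad_apply, map_add, LinearMap.add_apply, 𝔸.one_mul,
      𝔸.mul_comm _ 𝔸.one]
    module
  -- The symmetry at the origin is inversion at the unit, translated: `U_{s+1} ((s+1)⁻¹ - 1) = -s -
  -- s²`.
  have hq : J.quasiInverse (-φ s) a = φ (𝔸.inv (s + 𝔸.one) - 𝔸.one) := by
    rw [quasiInverse, B_neg_neg]
    refine Ring.inverse_end_apply_eq hs ?_
    rw [B_hom_apply J 𝔸 a φ hφ, map_sub, 𝔸.quad_inv_apply hs', hone, ← map_neg φ s, hsq]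
    simp only [map_add, map_sub, map_smul, map_neg, LinearMap.neg_apply, neg_neg]
    module
  rw [symMul, hq, B_hom_apply J 𝔸 a φ hφ, hsq, map_sub (𝔸.quad _), hone,
    UnitalJordanAlgebra.symMul]
  simp only [map_add, map_sub, map_smul]
  module

end Hom

section Base

variable [Invertible (3 : K)] {ep : Vp} {em : Vm} (h : J.IsIdempotent ep em)

theorem coe_peirceTwoAlgebra_quad_eq_Q (x z : J.peirce ep em 2) :
    ((J.peirceTwoAlgebra h).quad x z : Vp) = J.Q x (J.swap.Q em z) := by
  rw [coe_peirceTwoAlgebra_quad, Q_swap_Q]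

/-- Since `U_x = Q(x) Q(e⁻)`, the fundamental formula of the pair is applied twice, once in each of
the two opposite pairs. -/
theorem peirceTwoAlgebra_quad_quad (x y : J.peirce ep em 2) :
    (J.peirceTwoAlgebra h).quad ((J.peirceTwoAlgebra h).quad x y) =
      (J.peirceTwoAlgebra h).quad x * (J.peirceTwoAlgebra h).quad y *
        (J.peirceTwoAlgebra h).quad x := by
  ext z
  have e : ∀ b, J.swap.Q (J.swap.Q em y) b = J.swap.Q em (J.Q y (J.swap.Q em b)) :=
    J.swap.Q_fundamental em y
  simp only [Module.End.mul_apply, coe_peirceTwoAlgebra_quad_eq_Q, Q_fundamental, e]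

/-- With `q = Q(e⁻) x⁻¹` the left side is `T(x, q, v)`. Since `Q(x) q = x`, the operator `T(x, q)`
is multiplication by 2 on the range of `Q(x)`, which contains `v`. -/
theorem peirceTwoAlgebra_quadDiff_inv (x : J.peirce ep em 2)
    (hx : x ∈ (J.peirceTwoAlgebra h).invertibles) (v : J.peirce ep em 2) :
    (J.peirceTwoAlgebra h).quadDiff x v ((J.peirceTwoAlgebra h).inv x) = (2 : K) • v := by
  have hinv := congrArg Subtype.val ((J.peirceTwoAlgebra h).quad_inv_apply hx)
  have hv := congrArg Subtype.val (Ring.end_apply_inverse hx v)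
  generalize (J.peirceTwoAlgebra h).inv x = p at *
  generalize Ring.inverse ((J.peirceTwoAlgebra h).quad x) v = v' at *
  simp only [coe_peirceTwoAlgebra_quad_eq_Q] at hinv hv
  have hx2 : J.Tp x (J.swap.Q em p) x = (2 : K) • (x : Vp) := by
    conv_rhs => rw [← hinv]
    generalize J.swap.Q em p = q
    rw [Q_apply, smul_smul, mul_invOf_self, one_smul]
  have key : J.Tp x (J.swap.Q em p) v = (2 : K) • (v : Vp) := by
    rw [← hv, Q_apply (J := J) (x := (x : Vp)), map_smul, J.tp_of_tp_eq_two_smul hx2,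
      smul_comm]
  ext
  rw [Submodule.coe_smul, ← key, swap_Q_apply]
  have e := J.jordan_p p em x em v
  rw [J.symm_p p em x, J.symm_p p em v, J.symm_p p em (J.Tp x em v)] at e
  have e' : J.Tp x (J.Tm em p em) v = J.Tp (J.Tp x em p) em v + J.Tp x em (J.Tp v em p)
    - J.Tp (J.Tp x em v) em p := by
    linear_combination (norm := module) e
  rw [J.symm_p (J.Tp x em p) em v] at e'
  simp only [UnitalJordanAlgebra.quadDiff, Submodule.coe_smul, Submodule.coe_sub,
    Submodule.coe_add, coe_peirceTwoAlgebra_mul, map_smul, LinearMap.smul_apply, e', smul_add,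
    smul_sub, smul_smul]
  rw [← mul_assoc, mul_invOf_self, one_mul]
  abel

theorem peirceTwoAlgebra_isSymmetricSpace :
    (J.peirceTwoAlgebra h).symmetricSpace.IsSymmetricSpace :=
  UnitalJordanAlgebra.isSymmetricSpace _ (J.peirceTwoAlgebra_quad_quad h)
    (J.peirceTwoAlgebra_quadDiff_inv h)

theorem symMul_base (x : J.peirce ep em 2) {y : J.peirce ep em 2}
    (hy : (y : Vp) ∈ J.quasiInvertibles em) :
    J.symMul em x y = (J.peirceTwoAlgebra h).symMul (x + (J.peirceTwoAlgebra h).one)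
      (y + (J.peirceTwoAlgebra h).one) - ep :=
  J.symMul_hom (J.peirceTwoAlgebra h) em (J.peirce ep em 2).subtype (fun _ _ => rfl) hy
    ((J.coe_mem_quasiInvertibles_iff h y).1 hy)

theorem dual_symMul_base (x u : J.peirce ep em 2) {y : J.peirce ep em 2}
    (hy : (y : Vp) ∈ J.quasiInvertibles em) (v : J.peirce ep em 2) :
    J.dual.symMul (em, 0) (x, u) (y, v) =
      ((((J.peirceTwoAlgebra h).dual.symMul (x + (J.peirceTwoAlgebra h).one, u)
        (y + (J.peirceTwoAlgebra h).one, v)).1 : Vp) - ep,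
      (((J.peirceTwoAlgebra h).dual.symMul (x + (J.peirceTwoAlgebra h).one, u)
        (y + (J.peirceTwoAlgebra h).one, v)).2 : Vp)) := by
  have e := J.dual.symMul_hom (J.peirceTwoAlgebra h).dual (em, 0)
    ((J.peirce ep em 2).subtype.prodMap (J.peirce ep em 2).subtype) (fun p q => by
      simp only [UnitalJordanAlgebra.dual, dual, dualBilin_apply, dualTrilin_apply,
        LinearMap.prodMap_apply, Submodule.subtype_apply, coe_peirceTwoAlgebra_mul,
        Submodule.coe_add, Prod.smul_mk, map_zero, LinearMap.zero_apply, add_zero, smul_add])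
    (s := (y, v)) (t := (x, u)) (J.isUnit_dual_B hy v) (by
      have := UnitalJordanAlgebra.dual_mem_invertibles _
        ((J.coe_mem_quasiInvertibles_iff h y).1 hy) v
      simpa [UnitalJordanAlgebra.dual] using this)
  have e1 : (J.peirceTwoAlgebra h).dual.one = ((J.peirceTwoAlgebra h).one, 0) := rfl
  simp only [e1, LinearMap.prodMap_apply, Submodule.subtype_apply, Prod.mk_add_mk, add_zero,
    coe_peirceTwoAlgebra_one, ZeroMemClass.coe_zero] at e
  rw [e, Prod.mk_sub_mk, sub_zero]

end Base

end LinearJordanPair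

namespace LinearJordanPair

variable {K Vp Vm : Type*} [CommRing K] [Invertible (2 : K)] [Invertible (3 : K)]
  [AddCommGroup Vp] [Module K Vp] [AddCommGroup Vm] [Module K Vm]
  (J : LinearJordanPair K Vp Vm) {ep : Vp} {em : Vm}

theorem symMul_base_eq_coe (h : J.IsIdempotent ep em) (x : J.peirce ep em 2) {y : J.peirce ep em 2}
    (hy : (y : Vp) ∈ J.quasiInvertibles em) :
    J.symMul em x y = (((J.peirceTwoAlgebra h).symMul (x + (J.peirceTwoAlgebra h).one)
      (y + (J.peirceTwoAlgebra h).one) - (J.peirceTwoAlgebra h).one : J.peirce ep em 2) : Vp) :=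
  J.symMul_base h x hy

theorem base_isSymmetricSubspace (h : J.IsIdempotent ep em) :
    (J.symmetricSpace em).IsSymmetricSubspace (J.peirce ep em 2) := by
  have hS := J.peirceTwoAlgebra_isSymmetricSpace h
  have hU : ∀ x : J.peirce ep em 2, (x : Vp) ∈ J.quasiInvertibles em →
      x + (J.peirceTwoAlgebra h).one ∈ (J.peirceTwoAlgebra h).invertibles :=
    fun x => (J.coe_mem_quasiInvertibles_iff h x).1
  have hm : ∀ x y : J.peirce ep em 2, (x : Vp) ∈ J.quasiInvertibles em →
      (y : Vp) ∈ J.quasiInvertibles em →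
      (((J.peirceTwoAlgebra h).symMul (x + (J.peirceTwoAlgebra h).one)
      (y + (J.peirceTwoAlgebra h).one) - (J.peirceTwoAlgebra h).one : J.peirce ep em 2) : Vp) ∈
      J.quasiInvertibles em := by
    intro x y hx hy
    rw [J.coe_mem_quasiInvertibles_iff h, sub_add_cancel]
    exact hS.mul_mem _ (hU x hx) _ (hU y hy)
  constructor
  · rintro x ⟨hx, hx2⟩ y ⟨hy, hy2⟩
    lift x to J.peirce ep em 2 using hx2
    lift y to J.peirce ep em 2 using hy2
    change J.symMul em x y ∈ _
    rw [J.symMul_base_eq_coe h x hy]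
    exact ⟨hm x y hx hy, Submodule.coe_mem _⟩
  · rintro x ⟨hx, hx2⟩
    lift x to J.peirce ep em 2 using hx2
    change J.symMul em x x = x
    have e : (J.peirceTwoAlgebra h).symMul _ _ = _ := hS.fixed _ (hU x hx)
    rw [J.symMul_base_eq_coe h x hx, e, add_sub_cancel_right]
  · rintro x ⟨hx, hx2⟩ y ⟨hy, hy2⟩
    lift x to J.peirce ep em 2 using hx2
    lift y to J.peirce ep em 2 using hy2
    change J.symMul em x (J.symMul em x y) = y
    have e : (J.peirceTwoAlgebra h).symMul _ ((J.peirceTwoAlgebra h).symMul _ _) = _ :=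
      hS.involutive _ (hU x hx) _ (hU y hy)
    rw [J.symMul_base_eq_coe h x hy, J.symMul_base_eq_coe h x (hm x y hx hy), sub_add_cancel, e,
      add_sub_cancel_right]
  · rintro x ⟨hx, hx2⟩ y ⟨hy, hy2⟩ z ⟨hz, hz2⟩
    lift x to J.peirce ep em 2 using hx2
    lift y to J.peirce ep em 2 using hy2
    lift z to J.peirce ep em 2 using hz2
    change J.symMul em x (J.symMul em y (J.symMul em x z)) =
      J.symMul em (J.symMul em x y) z
    have e : (J.peirceTwoAlgebra h).symMul _ ((J.peirceTwoAlgebra h).symMul _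
        ((J.peirceTwoAlgebra h).symMul _ _)) = (J.peirceTwoAlgebra h).symMul
          ((J.peirceTwoAlgebra h).symMul _ _) _ :=
      hS.distrib _ (hU x hx) _ (hU y hy) _ (hU z hz)
    have hxz := hm x z hx hz
    have hyxz := hm y _ hy hxz
    rw [J.symMul_base_eq_coe h x hz, J.symMul_base_eq_coe h y hxz,
      J.symMul_base_eq_coe h x hyxz, J.symMul_base_eq_coe h x hy, J.symMul_base_eq_coe h _ hz]
    simp only [sub_add_cancel]
    rw [e]
  · rintro x ⟨hx, hx2⟩ y ⟨hy, hy2⟩ u ⟨-, hu⟩ v ⟨-, hv⟩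
    lift x to J.peirce ep em 2 using hx2
    lift y to J.peirce ep em 2 using hy2
    lift u to J.peirce ep em 2 using hu
    lift v to J.peirce ep em 2 using hv
    refine ⟨((J.peirceTwoAlgebra h).dual.symMul (x + (J.peirceTwoAlgebra h).one, u)
      (y + (J.peirceTwoAlgebra h).one, v)).2, ⟨Submodule.mem_top, Submodule.coe_mem _⟩,
      (J.dual_symMul_base h x u hy v).trans ?_⟩
    rw [UnitalJordanAlgebra.dual_symMul_fst _ _ _ (hU y hy), ← J.symMul_base h x hy]
    rfl
  · rintro x ⟨hx, hx2⟩ v ⟨-, hv⟩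
    lift x to J.peirce ep em 2 using hx2
    lift v to J.peirce ep em 2 using hv
    have e : (J.peirceTwoAlgebra h).dual.symMul (x + (J.peirceTwoAlgebra h).one, 0)
        (x + (J.peirceTwoAlgebra h).one, v) = (x + (J.peirceTwoAlgebra h).one, -v) :=
      hS.tangent_symm _ (hU x hx) v Submodule.mem_top
    refine (J.dual_symMul_base h x 0 hx v).trans ?_
    rw [e]
    simp [coe_peirceTwoAlgebra_one]

/-- The base is isomorphic to the space of invertible elements, by translation by `e⁺`. -/
noncomputable def baseIso (h : J.IsIdempotent ep em) :
    ((J.symmetricSpace em).restrict (J.peirce ep em 2)).Iso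
    (J.peirceTwoAlgebra h).symmetricSpace :=
  let e : ((J.symmetricSpace em).restrict (J.peirce ep em 2)).direction ≃ₗ[K]
      (J.peirceTwoAlgebra h).symmetricSpace.direction :=
    (LinearEquiv.ofEq _ _ (top_inf_eq (J.peirce ep em 2))).trans Submodule.topEquiv.symm
  let one : (J.peirceTwoAlgebra h).symmetricSpace.direction :=
    ⟨(J.peirceTwoAlgebra h).one, Submodule.mem_top⟩
  have hF : ∀ x, (PolyMap.quadratic one e.toLinearMap 0).eval x = one + e x := fun x => by
    rw [PolyMap.eval_quadratic]; simp
  have hG : ∀ y, (PolyMap.quadratic (-e.symm one) e.symm.toLinearMap 0).eval y =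
      -e.symm one + e.symm y := fun x => by
    rw [PolyMap.eval_quadratic]; simp
  have hdF : ∀ x v, (PolyMap.quadratic one e.toLinearMap 0).diff x v = e v := fun x v => by
    rw [PolyMap.diff_quadratic]; simp
  have hdG : ∀ y v, (PolyMap.quadratic (-e.symm one) e.symm.toLinearMap 0).diff y v =
      e.symm v := fun x v => by
    rw [PolyMap.diff_quadratic]; simp
  have hU : ∀ x : ((J.symmetricSpace em).restrict (J.peirce ep em 2)).direction, (x : Vp) ∈
      ((J.symmetricSpace em).restrict (J.peirce ep em 2)).carrier →
      (e x : J.peirce ep em 2) + (J.peirceTwoAlgebra h).one ∈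
        (J.peirceTwoAlgebra h).invertibles :=
    fun x hx => (J.coe_mem_quasiInvertibles_iff h (e x)).1 hx.1
  { toFun := PolyMap.quadratic one e.toLinearMap 0
    invFun := PolyMap.quadratic (-e.symm one) e.symm.toLinearMap 0
    map_mem := fun x hx => by
      rw [hF, add_comm]
      exact hU x hx
    inv_mem := fun y hy => by
      have e1 : ((-e.symm one + e.symm y : _) : Vp) =
          ((y - (J.peirceTwoAlgebra h).one : J.peirce ep em 2) : Vp) := by
        rw [Submodule.coe_sub, sub_eq_neg_add]
        rfl
      rw [hG, e1]
      refine ⟨(J.coe_mem_quasiInvertibles_iff h _).2 ?_, Submodule.coe_mem _⟩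
      rw [sub_add_cancel]
      exact hy
    left_inv := fun x _ => by rw [hF, hG]; simp
    right_inv := fun y _ => by rw [hF, hG]; simp
    diff_left_inv := fun x _ v => by rw [hdF, hdG]; simp
    diff_right_inv := fun x _ v => by rw [hdF, hdG]; simp
    map_mul := fun x y z _ hy hz => by
      rw [hF, hF, hF]
      have hz' : J.symMul em (e x : J.peirce ep em 2) (e y : J.peirce ep em 2) =
        (e z : J.peirce ep em 2) := hz
      rw [J.symMul_base_eq_coe h _ (y := e y) hy.1] at hz'
      have := sub_eq_iff_eq_add'.1 (Subtype.ext hz')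
      rw [add_comm one, add_comm one (e y)]
      exact this
    map_tangentMul := fun x y z u v w _ hy hz => by
      rw [hF, hF, hF, hdF, hdF, hdF]
      have hz' : J.dual.symMul (em, 0) ((e x : J.peirce ep em 2), (e u : J.peirce ep em 2))
        ((e y : J.peirce ep em 2), (e v : J.peirce ep em 2)) =
        (((e z : J.peirce ep em 2) : Vp), ((e w : J.peirce ep em 2) : Vp)) := hz
      rw [J.dual_symMul_base h _ _ (y := e y) hy.1, Prod.mk.injEq] at hz'
      rw [add_comm one, add_comm one (e y)]
      refine Prod.ext ?_ (Subtype.ext hz'.2)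
      have h1 : _ - (J.peirceTwoAlgebra h).one = (e z : J.peirce ep em 2) := Subtype.ext hz'.1
      exact sub_eq_iff_eq_add'.1 h1 }

/-! ### The fiber: a nilpotent homotope and its flattening. -/

section Fiber

/-- On `W` the Bergman operator reduces to `1 + T(x, a)`, and the series for the quasi-inverse
stops: `(-y)^a = -y + ½ T(y, a, y)`. General `W` and `a` allow the use in the dual-number extension.
-/
theorem symMul_of_nilpotent {a : Vm} {W : Submodule K Vp} (hB : ∀ x ∈ W, IsUnit (J.B x (-a)))
    (hT : ∀ x ∈ W, ∀ y ∈ W, J.Tp x a y ∈ W)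
    (hT' : ∀ x ∈ W, ∀ y ∈ W, ∀ z ∈ W, J.Tp x a (J.Tp y a z) = 0) {x y : Vp} (hx : x ∈ W)
    (hy : y ∈ W) :
    J.symMul a x y = (2 : K) • x - y + (⅟2 : K) • J.Tp (x - y) a (x - y) := by
  have hBz : ∀ x ∈ W, ∀ z ∈ W, J.B x (-a) z = z + J.Tp x a z := by
    intro x hx z hz
    rw [B_neg_apply, hT' x hx x hx z hz, J.symm_p (J.Tp x a x), hT' z hz x hx x hx]
    simp
  have hp : (⅟2 : K) • J.Tp y a y - y ∈ W := W.sub_mem (W.smul_mem _ (hT y hy y hy)) hy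
  have hh : ∀ x : Vp, (⅟2 : K) • x + (⅟2 : K) • x = x := by
    intro x; rw [← add_smul, ← two_mul, mul_invOf_self, one_smul]
  have hq : J.quasiInverse (-y) a = (⅟2 : K) • J.Tp y a y - y := by
    rw [quasiInverse, B_neg_neg]
    refine Ring.inverse_end_apply_eq (hB y hy) ?_
    rw [hBz y hy _ hp, Q_apply]
    simp only [map_sub, map_smul, hT' y hy y hy y hy, map_neg, LinearMap.neg_apply]
    linear_combination (norm := module) hh (J.Tp y a y)
  rw [symMul, hq, hBz x hx _ hp, Q_apply]
  simp only [map_sub, map_smul, hT' x hx y hy y hy, LinearMap.sub_apply, J.symm_p y a x]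
  linear_combination (norm := module) hh (J.Tp x a y)

theorem fiber_tp_mem (h : J.IsIdempotent ep em) {x y : Vp} (hx : x ∈ J.peirce ep em 1 ⊔ J.peirce ep em 0)
    (hy : y ∈ J.peirce ep em 1 ⊔ J.peirce ep em 0) : J.Tp x em y ∈ J.peirce ep em 0 := by
  obtain ⟨x1, h1, x0, h0, rfl⟩ := Submodule.mem_sup.1 hx
  obtain ⟨y1, h1', y0, h0', rfl⟩ := Submodule.mem_sup.1 hy
  simp only [map_add, LinearMap.add_apply, J.tp_peirce_zero h h0, J.tp_peirce_zero_right h h0',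
    add_zero]
  exact J.tp_peirce_one_one h h1 h1'

theorem symMul_fiber (h : J.IsIdempotent ep em) {x y : Vp} (hx : x ∈ J.peirce ep em 1 ⊔ J.peirce ep em 0)
    (hy : y ∈ J.peirce ep em 1 ⊔ J.peirce ep em 0) :
    J.symMul em x y = (2 : K) • x - y + (⅟2 : K) • J.Tp (x - y) em (x - y) :=
  J.symMul_of_nilpotent (fun _ hx => J.fiber_subset_quasiInvertibles h hx)
    (fun _ hx _ hy => Submodule.mem_sup_right (J.fiber_tp_mem h hx hy))
    (fun _ _ _ hy _ hz => J.tp_peirce_zero_right h (J.fiber_tp_mem h hy hz) _) hx hy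

theorem dual_symMul_fiber (h : J.IsIdempotent ep em) {x y u v : Vp} (hx : x ∈ J.peirce ep em 1 ⊔ J.peirce ep em 0)
    (hy : y ∈ J.peirce ep em 1 ⊔ J.peirce ep em 0)
    (hu : u ∈ J.peirce ep em 1 ⊔ J.peirce ep em 0)
    (hv : v ∈ J.peirce ep em 1 ⊔ J.peirce ep em 0) :
    J.dual.symMul (em, 0) (x, u) (y, v) =
      (J.symMul em x y, (2 : K) • u - v + J.Tp (x - y) em (u - v)) := by
  have hT : ∀ p q : Vp × Vp, J.dual.Tp p (em, 0) q =
      (J.Tp p.1 em q.1, J.Tp p.2 em q.1 + J.Tp p.1 em q.2) := by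
    intro p q
    simp [dual, dualTrilin_apply]
  have e := J.dual.symMul_of_nilpotent (a := (em, 0))
    (W := (J.peirce ep em 1 ⊔ J.peirce ep em 0).prod (J.peirce ep em 1 ⊔ J.peirce ep em 0))
    (fun x hx => J.isUnit_dual_B (J.fiber_subset_quasiInvertibles h hx.1) x.2)
    (fun x hx y hy => by
      rw [hT]
      exact ⟨Submodule.mem_sup_right (J.fiber_tp_mem h hx.1 hy.1),
        Submodule.mem_sup_right (Submodule.add_mem _ (J.fiber_tp_mem h hx.2 hy.1)
          (J.fiber_tp_mem h hx.1 hy.2))⟩)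
    (fun x hx y hy z hz => by
      rw [hT, hT]
      have z1 := fun w => J.tp_peirce_zero_right h (J.fiber_tp_mem h hy.1 hz.1) w
      have z2 := fun w => J.tp_peirce_zero_right h (J.fiber_tp_mem h hy.2 hz.1) w
      have z3 := fun w => J.tp_peirce_zero_right h (J.fiber_tp_mem h hy.1 hz.2) w
      simp [z1, z2, z3])
    (x := (x, u)) (y := (y, v)) ⟨hx, hu⟩ ⟨hy, hv⟩
  rw [e, hT, J.symMul_fiber h hx hy, J.symm_p (((x, u) - (y, v) : Vp × Vp).2)]
  ext
  · rfl
  · simp only [Prod.snd_add, Prod.snd_sub, Prod.smul_snd, Prod.fst_sub]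
    rw [← two_smul K, smul_smul, invOf_mul_self, one_smul]

theorem fiber_isSymmetricSubspace (h : J.IsIdempotent ep em) :
    (J.symmetricSpace em).IsSymmetricSubspace (J.peirce ep em 1 ⊔ J.peirce ep em 0) := by
  have hU := J.fiber_subset_quasiInvertibles h
  have hS := fun {x y : Vp} => J.symMul_fiber h (x := x) (y := y)
  have hT := fun {x y : Vp} => J.fiber_tp_mem h (x := x) (y := y)
  have hm : ∀ {x y : Vp}, x ∈ J.peirce ep em 1 ⊔ J.peirce ep em 0 →
      y ∈ J.peirce ep em 1 ⊔ J.peirce ep em 0 →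
      J.symMul em x y ∈ J.peirce ep em 1 ⊔ J.peirce ep em 0 := by
    intro x y hx hy
    rw [hS hx hy]
    have hxy := Submodule.sub_mem _ hx hy
    exact Submodule.add_mem _ (Submodule.sub_mem _ (Submodule.smul_mem _ _ hx) hy)
      (Submodule.smul_mem _ _ (Submodule.mem_sup_right (hT hxy hxy)))
  have hz : ∀ {x y : Vp}, x ∈ J.peirce ep em 1 ⊔ J.peirce ep em 0 →
      y ∈ J.peirce ep em 1 ⊔ J.peirce ep em 0 → ∀ w, J.Tp w em (J.Tp x em y) = 0 :=
    fun hx hy => J.tp_peirce_zero_right h (hT hx hy)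
  have hz' : ∀ {x y : Vp}, x ∈ J.peirce ep em 1 ⊔ J.peirce ep em 0 →
      y ∈ J.peirce ep em 1 ⊔ J.peirce ep em 0 → ∀ w, J.Tp (J.Tp x em y) em w = 0 :=
    fun hx hy => J.tp_peirce_zero h (hT hx hy)
  constructor
  · rintro x ⟨-, hx⟩ y ⟨-, hy⟩
    exact ⟨hU (hm hx hy), hm hx hy⟩
  · rintro x ⟨-, hx⟩
    change J.symMul em x x = x
    rw [hS hx hx, sub_self, map_zero, smul_zero]
    module
  · rintro x ⟨-, hx⟩ y ⟨-, hy⟩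
    change J.symMul em x (J.symMul em x y) = y
    rw [hS hx (hm hx hy), hS hx hy]
    simp only [SetLike.mem_coe] at hx hy
    simp only [map_add, map_sub, map_smul, LinearMap.add_apply, LinearMap.sub_apply,
      LinearMap.smul_apply, hz hx hx, hz hx hy, hz hy hx, hz hy hy, hz' hx hx, hz' hx hy,
      hz' hy hx, hz' hy hy]
    module
  · rintro x ⟨-, hx⟩ y ⟨-, hy⟩ z ⟨-, hw⟩
    change J.symMul em x (J.symMul em y (J.symMul em x z)) =
      J.symMul em (J.symMul em x y) z
    simp only [SetLike.mem_coe] at hx hy hw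
    -- Squares ignore summands in `V₀`, so inside the quadratic terms every product may be replaced
    -- by the flat one `2x - y`.
    have hsq : ∀ a c, c ∈ J.peirce ep em 0 → J.Tp (a + c) em (a + c) = J.Tp a em a := by
      intro a c hc
      simp only [map_add, LinearMap.add_apply, J.tp_peirce_zero h hc,
        J.tp_peirce_zero_right h hc, add_zero]
    have hd : ∀ {a b}, a ∈ J.peirce ep em 1 ⊔ J.peirce ep em 0 →
        b ∈ J.peirce ep em 1 ⊔ J.peirce ep em 0 →
        (⅟2 : K) • J.Tp (a - b) em (a - b) ∈ J.peirce ep em 0 := fun ha hb =>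
      Submodule.smul_mem _ _ (hT (Submodule.sub_mem _ ha hb) (Submodule.sub_mem _ ha hb))
    have hxz := hm hx hw
    have e1 := hsq (y - (2 : K) • x + z) _ (Submodule.neg_mem _ (hd hx hw))
    have e2 := hsq ((3 : K) • x - (2 : K) • y - z) _
      (Submodule.sub_mem _ (hd hx hw) (hd hy hxz))
    have e3 := hsq ((2 : K) • x - y - z) _ (hd hx hy)
    have f1 : y - J.symMul em x z = y - (2 : K) • x + z +
        -((⅟2 : K) • J.Tp (x - z) em (x - z)) := by
      rw [hS hx hw]; abel
    have f2 : x - J.symMul em y (J.symMul em x z) = (3 : K) • x - (2 : K) • y - z +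
        ((⅟2 : K) • J.Tp (x - z) em (x - z) - (⅟2 : K) • J.Tp (y - J.symMul em x z) em
          (y - J.symMul em x z)) := by
      rw [hS hy hxz]
      linear_combination (norm := module) hS hx hw
    have f3 : J.symMul em x y - z = (2 : K) • x - y - z +
        (⅟2 : K) • J.Tp (x - y) em (x - y) := by
      rw [hS hx hy]; abel
    rw [hS hx (hm hy hxz), hS (hm hx hy) hw, f2, f3, e2, e3, hS hy hxz, f1, e1, hS hx hy,
      hS hx hw]
    simp only [map_add, map_sub, map_smul, LinearMap.add_apply, LinearMap.sub_apply,
      LinearMap.smul_apply, J.symm_p y em x, J.symm_p z em x, J.symm_p z em y]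
    module
  · rintro x ⟨-, hx⟩ y ⟨-, hy⟩ u ⟨-, hu⟩ v ⟨-, hv⟩
    exact ⟨_, ⟨Submodule.mem_top, Submodule.add_mem _
      (Submodule.sub_mem _ (Submodule.smul_mem _ _ hu) hv) (Submodule.mem_sup_right
      (hT (Submodule.sub_mem _ hx hy) (Submodule.sub_mem _ hu hv)))⟩,
      J.dual_symMul_fiber h hx hy hu hv⟩
  · rintro x ⟨-, hx⟩ v ⟨-, hv⟩
    refine (J.dual_symMul_fiber h hx hx (Submodule.zero_mem _) hv).trans ?_
    rw [hS hx hx]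
    simp only [sub_self, map_zero, smul_zero, zero_sub, add_zero, LinearMap.zero_apply,
      Prod.mk.injEq, and_true]
    module

/-- The fiber is isomorphic to the flat symmetric space, by `x ↦ x - ¼ T(x, e⁻, x)`. -/
noncomputable def fiberIso (h : J.IsIdempotent ep em) :
    ((J.symmetricSpace em).restrict (J.peirce ep em 1 ⊔ J.peirce ep em 0)).Iso
      (SymmetricSpaceData.flat (J.peirce ep em 1 ⊔ J.peirce ep em 0)) :=
  let e : ((J.symmetricSpace em).restrict
        (J.peirce ep em 1 ⊔ J.peirce ep em 0)).direction ≃ₗ[K]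
      (SymmetricSpaceData.flat (J.peirce ep em 1 ⊔ J.peirce ep em 0)).direction :=
    LinearEquiv.ofEq _ _ (top_inf_eq (J.peirce ep em 1 ⊔ J.peirce ep em 0))
  let b : (SymmetricSpaceData.flat (J.peirce ep em 1 ⊔ J.peirce ep em 0)).direction →ₗ[K]
      (SymmetricSpaceData.flat (J.peirce ep em 1 ⊔ J.peirce ep em 0)).direction →ₗ[K]
      (SymmetricSpaceData.flat (J.peirce ep em 1 ⊔ J.peirce ep em 0)).direction :=
    LinearMap.mk₂ K (fun x y => ⟨(⅟2 * ⅟2 : K) • J.Tp x em y, Submodule.smul_mem _ _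
        (Submodule.mem_sup_right (J.fiber_tp_mem h x.2 y.2))⟩)
      (by intro x y z; ext; simp) (by intro r x y; ext; simp [smul_comm r])
      (by intro x y z; ext; simp) (by intro r x y; ext; simp [smul_comm r])
  have hb : ∀ x y, (b x y : Vp) = (⅟2 * ⅟2 : K) • J.Tp x em y := fun _ _ => rfl
  have hbl : ∀ x y z, b (b x y) z = 0 := fun x y z => by
    ext
    rw [hb, hb, map_smul, LinearMap.smul_apply, LinearMap.smul_apply,
      J.tp_peirce_zero h (J.fiber_tp_mem h x.2 y.2)]
    simp
  have hbs : ∀ x y, b x y = b y x := fun x y => by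
    ext
    rw [hb, hb, J.symm_p]
  have hbr : ∀ x y z, b x (b y z) = 0 := fun x y z => by rw [hbs, hbl]
  have hF : ∀ x, (PolyMap.quadratic 0 e.toLinearMap
      (-b.compl₁₂ e.toLinearMap e.toLinearMap)).eval x = e x - b (e x) (e x) := fun x => by
    rw [PolyMap.eval_quadratic]; simp [sub_eq_add_neg]
  have hG : ∀ y, (PolyMap.quadratic 0 e.symm.toLinearMap
      (b.compr₂ e.symm.toLinearMap)).eval y = e.symm (y + b y y) := fun x => by
    rw [PolyMap.eval_quadratic]; simp
  have hdF : ∀ x v, (PolyMap.quadratic 0 e.toLinearMap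
      (-b.compl₁₂ e.toLinearMap e.toLinearMap)).diff x v =
        e v - (2 : K) • b (e x) (e v) := fun x v => by
    rw [PolyMap.diff_quadratic]
    simp only [LinearMap.neg_apply, LinearMap.compl₁₂_apply, LinearEquiv.coe_coe,
      hbs (e v) (e x)]
    module
  have hdG : ∀ y v, (PolyMap.quadratic 0 e.symm.toLinearMap
      (b.compr₂ e.symm.toLinearMap)).diff y v = e.symm (v + (2 : K) • b y v) := fun y v => by
    rw [PolyMap.diff_quadratic]
    simp only [LinearMap.compr₂_apply, LinearEquiv.coe_coe, hbs v y, map_add, map_smul]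
    module
  -- As `b` is `¼ T`, the quadratic term `½ T` equals `2 b`. This choice makes `F(x) = x - b(x, x)`
  -- satisfy `F(2x - y + 2b(x-y, x-y)) = 2F(x) - F(y)`, and `y + b(y, y)` inverts `F` because nested
  -- values of `b` vanish.
  have hmul : ∀ x y z, J.symMul em (e x : Vp) (e y : Vp) = (e z : Vp) →
      e z = (2 : K) • e x - e y + (2 : K) • b (e x - e y) (e x - e y) := fun x y z hz => by
    rw [J.symMul_fiber h (e x).2 (e y).2] at hz
    ext
    rw [← hz, Submodule.coe_add, Submodule.coe_smul, hb, smul_smul, ← mul_assoc,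
      mul_invOf_self, one_mul]
    rfl
  { toFun := PolyMap.quadratic 0 e.toLinearMap (-b.compl₁₂ e.toLinearMap e.toLinearMap)
    invFun := PolyMap.quadratic 0 e.symm.toLinearMap (b.compr₂ e.symm.toLinearMap)
    map_mem := fun x _ => Submodule.coe_mem _
    inv_mem := fun y _ => by
      have hm := (top_inf_eq (J.peirce ep em 1 ⊔ J.peirce ep em 0)).le (Submodule.coe_mem
        ((PolyMap.quadratic 0 e.symm.toLinearMap (b.compr₂ e.symm.toLinearMap)).eval y))
      exact ⟨J.fiber_subset_quasiInvertibles h hm, hm⟩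
    left_inv := fun x _ => by
      rw [hF, hG, LinearEquiv.symm_apply_eq]
      simp [hbl, hbr]
    right_inv := fun y _ => by
      rw [hF, hG]
      simp [hbl, hbr]
    diff_left_inv := fun x _ v => by
      rw [hF, hdF, hdG, LinearEquiv.symm_apply_eq]
      simp [hbl, hbr]
    diff_right_inv := fun x _ v => by
      rw [hG, hdF, hdG]
      simp [hbl, hbr]
    map_mul := fun x y z _ _ hz => by
      change (2 : K) • (_ : Vp) - _ = _
      rw [← Submodule.coe_smul, ← Submodule.coe_sub, hF, hF, hF, hmul x y z hz]
      congr 1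
      simp only [map_add, map_sub, map_smul, LinearMap.add_apply, LinearMap.sub_apply,
        LinearMap.smul_apply, hbl, hbr, hbs (e y) (e x)]
      module
    map_tangentMul := fun x y z u v w _ _ hz => by
      have hz' : J.dual.symMul (em, 0) ((e x : Vp), (e u : Vp)) ((e y : Vp), (e v : Vp)) =
        ((e z : Vp), (e w : Vp)) := hz
      rw [J.dual_symMul_fiber h (e x).2 (e y).2 (e u).2 (e v).2, Prod.mk.injEq] at hz'
      -- The factor 4 only undoes the normalization of `b`; the formula is the differential of the
      -- one in `hmul`.
      have hw : e w = (2 : K) • e u - e v + (4 : K) • b (e x - e y) (e u - e v) := by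
        ext
        rw [← hz'.2, Submodule.coe_add, Submodule.coe_smul, hb, smul_smul,
          show (4 : K) * (⅟2 * ⅟2) = (2 * ⅟2) * (2 * ⅟2) by ring, mul_invOf_self, one_mul,
          one_smul]
        rfl
      change (2 : K) • ((_ : Vp), (_ : Vp)) - ((_ : Vp), (_ : Vp)) = _
      rw [Prod.smul_mk, Prod.mk_sub_mk, ← Submodule.coe_smul, ← Submodule.coe_sub,
        ← Submodule.coe_smul, ← Submodule.coe_sub, hF, hF, hF, hdF, hdF, hdF, hw,
        hmul x y z hz'.1]
      congr 2
      all_goals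
        simp only [map_add, map_sub, map_smul, LinearMap.add_apply, LinearMap.sub_apply,
          LinearMap.smul_apply, hbl, hbr, hbs (e y) (e x)]
        module }

end Fiber

end LinearJordanPair

theorem theorem6p4 {K Vp Vm : Type*} [CommRing K] [Invertible (2 : K)] [Invertible (3 : K)]
    [AddCommGroup Vp] [Module K Vp] [AddCommGroup Vm] [Module K Vm]
    (J : LinearJordanPair K Vp Vm) (ep : Vp) (em : Vm) (h : J.IsIdempotent ep em) :
    -- the Peirce decomposition
    DirectSum.IsInternal (J.peirce ep em) ∧
    -- description of the set `U_e`
    J.quasiInvertibles em =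
      {x | ∃ x₀ ∈ J.peirce ep em 0, ∃ x₁ ∈ J.peirce ep em 1, ∃ x₂ : J.peirce ep em 2,
        x = x₀ + x₁ + x₂ ∧
          x₂ + (J.peirceTwoAlgebra h).one ∈ (J.peirceTwoAlgebra h).invertibles} ∧
    -- the base
    J.quasiInvertibles em ∩ J.peirce ep em 2 =
      (fun z : J.peirce ep em 2 => (z : Vp) - ep) '' (J.peirceTwoAlgebra h).invertibles ∧
    (J.symmetricSpace em).IsSymmetricSubspace (J.peirce ep em 2) ∧
    Nonempty (((J.symmetricSpace em).restrict (J.peirce ep em 2)).Iso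
      (J.peirceTwoAlgebra h).symmetricSpace) ∧
    -- the fiber
    ((J.peirce ep em 1 ⊔ J.peirce ep em 0 : Submodule K Vp) : Set Vp) ⊆
      J.quasiInvertibles em ∧
    (J.symmetricSpace em).IsSymmetricSubspace (J.peirce ep em 1 ⊔ J.peirce ep em 0) ∧
    Nonempty (((J.symmetricSpace em).restrict (J.peirce ep em 1 ⊔ J.peirce ep em 0)).Iso
      (SymmetricSpaceData.flat (J.peirce ep em 1 ⊔ J.peirce ep em 0))) := by
  exact ⟨J.isInternal_peirce h, J.quasiInvertibles_eq h, J.quasiInvertibles_inter_peirce_two h,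
    J.base_isSymmetricSubspace h, ⟨J.baseIso h⟩, J.fiber_subset_quasiInvertibles h,
    J.fiber_isSymmetricSubspace h, ⟨J.fiberIso h⟩⟩
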